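/- **Setting.** For $a>0$ let $\lfloor a\rfloor$ denote the largest integer strictly smaller than $a$. Let $R$ be a known $d_x\times d_z$ matrix of full column rank, let $(x_t,\epsilon_t)_{t\ge 1}$ be random variables with $x_t\in\mathcal X$, where $\mathcal X\subset\mathbb R^{d_x}$ is convex and bounded, and $\epsilon_t\in\mathbb R$, and put $z_t=R'x_t$. For each sample size $T$ the responses are $$y_t=x_t'\beta_0+\mathbf 1\{t>\lfloor\tau_0T\rfloor\}\,z_t'\delta_0+\epsilon_t,\qquad t=1,\dots,T,$$ with true slopes $\gamma_0=(\beta_0,\delta_0)\in\mathbb R^{d_x+d_z}$ and true break location $\tau_0$. The set $\mathcal H\subset(0,1)$ of candidate break locations is a Borel set that contains a nondegenerate closed interval to which $\tau_0$ belongs. **Assumption 1 (data generating process).** The process $(x_t,\epsilon_t)_{t\ge1}$ is strictly stationary, and 1. $\delta_0\neq0$; 2. the $\epsilon_t$ are i.i.d. and square integrable, with $E(\epsilon_t\mid x_t)=0$ and $E(\epsilon_t^2\mid x_t)=\sigma_0^2>0$; 3. $\Sigma_X=E[x_tx_t']=\operatorname{plim}_{T\to\infty}\frac1T\sum_{t=1}^Tx_tx_t'$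 exists and is positive definite; 4. for all $0<\tau_1<\tau_2<1$, $$\frac1T\sum_{t=\lfloor\tau_1T\rfloor+1}^{\lfloor\tau_2T\rfloor}x_t\epsilon_t=O_p(T^{-1/2}),\qquad \frac1T\sum_{t=\lfloor\tau_1T\rfloor+1}^{\lfloor\tau_2T\rfloor}x_tx_t'=(\tau_2-\tau_1)\Sigma_X+O_p(T^{-1/2}).$$ **Model and posterior.** For $\theta=(\beta,\delta,\sigma^2)$ with $\sigma^2>0$, the (possibly misspecified) normal likelihood is $$p(Y_T\mid X_T,\theta,\tau)=\prod_{t=1}^T\frac1{\sqrt{2\pi\sigma^2}}\exp\left(-\frac{\left(y_t-x_t'\beta-\mathbf 1\{t>\lfloor\tau T\rfloor\}z_t'\delta\right)^2}{2\sigma^2}\right).$$ For $\tau\in\mathcal H$ let $\theta^*(\tau)$ be the pseudo-true parameter: the value that minimizes, over all $\theta$ with $\sigma^2>0$, the limit as $T\to\infty$ of the Kullback–Leibler divergence per observation of the model $p(\cdot\mid X_T,\theta,\tau)$ from the data generating process (equivalently, $\lim_T T^{-1}E[\log p(Y_T\mid X_T,\theta^*(\tau),\tau)-\log p(Y_T\mid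 X_T,\theta,\tau)]\ge0$ for all such $\theta$). Given a prior probability density $\pi(\theta,\tau)$, put $$L_T(\tau)=\int p(Y_T\mid X_T,\theta,\tau)\,\pi(\theta,\tau)\,d\theta,\qquad \pi_T(\tau)=\frac{L_T(\tau)}{\int_{\mathcal H}L_T(s)\,ds}.$$ **Assumption 2 (parameter space and prior).** 1. $\Theta\subset\mathbb R^{d_x+d_z}\times(0,\infty)$ is compact and convex, and $\theta^*(\tau)\in\operatorname{int}\Theta$ for all $\tau\in\mathcal H$; 2. the prior density $\pi$ vanishes outside $\Theta\times\mathcal H$, and for every $\tau\in\mathcal H$ it is, on the intersection of some neighbourhood of $(\theta^*(\tau),\tau)$ with $\Theta\times\mathcal H$, continuous in $\theta$ and bounded away from $0$ and $\infty$. **Theorem.** Under Assumptions 1 and 2 the marginal posterior density $\pi_T$ is well defined for every $T$ and every sample ($L_T$ is integrable over $\mathcal H$ with positive integral), and it contracts around $\tau_0$ at rate $T^{-1}$: for all $\eta>0$ and $\epsilon>0$ there are $M>0$ and an integer $k>0$ such that for all $T\ge k$ $$P_{\theta_0,\tau_0}\left(\int_{\mathcal H\setminus(\tau_0-M/T,\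 \tau_0+M/T)}\pi_T(\tau)\,d\tau<\eta\right)>1-\epsilon .$$ Here $P_{\theta_0,\tau_0}$ is the law of the data generating process, with $\theta_0=(\gamma_0,\sigma_0^2)$. -/

import Mathlib

open MeasureTheory ProbabilityTheory Filter Set Topology
open scoped Matrix

noncomputable section

namespace BreakModel

/-- The regression parameter `θ = ((β, δ), σ²)`, a point of `ℝ ^ (dx + dz + 1)`. -/
abbrev Param (dx dz : ℕ) : Type := ((Fin dx → ℝ) × (Fin dz → ℝ)) × ℝ

/-- The largest integer strictly smaller than `a`, for `a > 0`. -/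
def strictFloor (a : ℝ) : ℕ := ⌈a⌉₊ - 1

lemma strictFloor_spec {a : ℝ} (ha : 0 < a) :
    (strictFloor a : ℝ) < a ∧ a ≤ (strictFloor a : ℝ) + 1 := by
  have h1 : 1 ≤ ⌈a⌉₊ := Nat.one_le_iff_ne_zero.mpr (Nat.ceil_pos.mpr ha).ne'
  have h2 : (strictFloor a : ℝ) = (⌈a⌉₊ : ℝ) - 1 := by
    unfold strictFloor
    push_cast [Nat.cast_sub h1]
    ring
  have h3 := Nat.le_ceil a
  have h4 := Nat.ceil_lt_add_one ha.le
  constructor <;> linarith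

/-! Observations are indexed from zero: index `t : ℕ` stands for date `t + 1`, so that the sample
of size `T` is `Finset.range T`, and date `t + 1` lies after the break `⌊τ T⌋` exactly when
`strictFloor (τ * T) ≤ t`. -/

/-- The regression function `χ_{τ,t}' γ = x_t' β + 1{t > ⌊τ T⌋} z_t' δ`, where `z_t = R' x_t`. -/
def regMean {dx dz : ℕ} (R : Matrix (Fin dx) (Fin dz) ℝ) (T : ℕ) (τ : ℝ)
    (γ : (Fin dx → ℝ) × (Fin dz → ℝ)) (t : ℕ) (xt : Fin dx → ℝ) : ℝ :=
  xt ⬝ᵥ γ.1 + if strictFloor (τ * T) ≤ t then (Rᵀ *ᵥ xt) ⬝ᵥ γ.2 else 0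

/-- The normal likelihood `p(Y_T | X_T, θ, τ)`. -/
def normalLik {dx dz : ℕ} (R : Matrix (Fin dx) (Fin dz) ℝ) (T : ℕ)
    (y : ℕ → ℝ) (x : ℕ → Fin dx → ℝ) (θ : Param dx dz) (τ : ℝ) : ℝ :=
  ∏ t ∈ Finset.range T, (1 / √(2 * Real.pi * θ.2)) *
    Real.exp (-(y t - regMean R T τ θ.1 t (x t)) ^ 2 / (2 * θ.2))

/-- The marginal likelihood `L_T(τ) = ∫ p(Y_T | X_T, θ, τ) π(θ, τ) dθ`. -/
def margLik {dx dz : ℕ} (R : Matrix (Fin dx) (Fin dz) ℝ) (prior : Param dx dz × ℝ → ℝ) (T : ℕ)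
    (y : ℕ → ℝ) (x : ℕ → Fin dx → ℝ) (τ : ℝ) : ℝ :=
  ∫ θ : Param dx dz, normalLik R T y x θ τ * prior (θ, τ)

/-- The marginal posterior density `π_T(τ) = L_T(τ) / ∫_H L_T`. -/
def margPosterior {dx dz : ℕ} (R : Matrix (Fin dx) (Fin dz) ℝ) (prior : Param dx dz × ℝ → ℝ)
    (H : Set ℝ) (T : ℕ) (y : ℕ → ℝ) (x : ℕ → Fin dx → ℝ) (τ : ℝ) : ℝ :=
  margLik R prior T y x τ / ∫ s in H, margLik R prior T y x s

section Probability

variable {Ω : Type*} [MeasurableSpace Ω]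

/-- The responses in the sample of size `T`, generated with slopes `γ₀` and break `τ₀`. -/
def response {dx dz : ℕ} (R : Matrix (Fin dx) (Fin dz) ℝ) (x : ℕ → Ω → Fin dx → ℝ)
    (ε : ℕ → Ω → ℝ) (γ₀ : (Fin dx → ℝ) × (Fin dz → ℝ)) (τ₀ : ℝ) (T : ℕ) (ω : Ω) (t : ℕ) : ℝ :=
  regMean R T τ₀ γ₀ t (x t ω) + ε t ω

/-- `Y_T = O_p(a_T)` as `T → ∞`. -/
def IsBigOInProb (μ : Measure Ω) (Y : ℕ → Ω → ℝ) (a : ℕ → ℝ) : Prop :=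
  ∀ e : ℝ, 0 < e → ∃ C : ℝ, 0 < C ∧ ∃ k : ℕ, ∀ T ≥ k, μ.real {ω | C * a T < |Y T ω|} < e

/-- The assumptions on the data generating process of the covariates `x` and the errors `ε`, with
true jump `δ₀`, error variance `σ₀sq`, second moment matrix `SigmaX`, and `X` the space in which
the covariates take their values. -/
structure RegularDGP {dx dz : ℕ} (μ : Measure Ω) (X : Set (Fin dx → ℝ))
    (x : ℕ → Ω → Fin dx → ℝ) (ε : ℕ → Ω → ℝ) (δ₀ : Fin dz → ℝ) (σ₀sq : ℝ)
    (SigmaX : Matrix (Fin dx) (Fin dx) ℝ) : Prop where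
  measurable_x : ∀ t, Measurable (x t)
  measurable_err : ∀ t, Measurable (ε t)
  convex_X : Convex ℝ X
  bounded_X : Bornology.IsBounded X
  x_mem : ∀ t, ∀ᵐ ω ∂μ, x t ω ∈ X
  /-- `(x_t, ε_t)` is a strictly stationary process. -/
  stationary : IdentDistrib (fun ω (t : ℕ) => (x (t + 1) ω, ε (t + 1) ω))
    (fun ω (t : ℕ) => (x t ω, ε t ω)) μ μ
  jump_ne_zero : δ₀ ≠ 0
  variance_pos : 0 < σ₀sq
  err_indep : iIndepFun ε μ
  err_identDistrib : ∀ t, IdentDistrib (ε t) (ε 0) μ μ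
  err_memLp : ∀ t, MemLp (ε t) 2 μ
  err_condMean : ∀ t, μ[ε t | MeasurableSpace.comap (x t) inferInstance] =ᵐ[μ] fun _ => 0
  err_condVar : ∀ t, μ[fun ω => ε t ω ^ 2 | MeasurableSpace.comap (x t) inferInstance]
    =ᵐ[μ] fun _ => σ₀sq
  secondMoment : ∀ t i j, ∫ ω, x t ω i * x t ω j ∂μ = SigmaX i j
  secondMoment_plim : ∀ i j, TendstoInMeasure μ
    (fun (T : ℕ) ω => (1 / (T : ℝ)) * ∑ t ∈ Finset.range T, x t ω i * x t ω j)
    atTop (fun _ => SigmaX i j)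
  secondMoment_posDef : SigmaX.PosDef
  partialSum_err : ∀ τ₁ τ₂ : ℝ, 0 < τ₁ → τ₁ < τ₂ → τ₂ < 1 → ∀ i, IsBigOInProb μ
    (fun T ω => (1 / (T : ℝ)) *
      ∑ t ∈ Finset.Ico (strictFloor (τ₁ * T)) (strictFloor (τ₂ * T)), x t ω i * ε t ω)
    (fun T => 1 / √(T : ℝ))
  partialSum_x : ∀ τ₁ τ₂ : ℝ, 0 < τ₁ → τ₁ < τ₂ → τ₂ < 1 → ∀ i j, IsBigOInProb μ
    (fun T ω => (1 / (T : ℝ)) *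
      ∑ t ∈ Finset.Ico (strictFloor (τ₁ * T)) (strictFloor (τ₂ * T)), x t ω i * x t ω j
        - (τ₂ - τ₁) * SigmaX i j)
    (fun T => 1 / √(T : ℝ))

/-- The expectation `E[log p(Y_T | X_T, θ, τ)]` under the data generating process. -/
def meanLogLik {dx dz : ℕ} (μ : Measure Ω) (R : Matrix (Fin dx) (Fin dz) ℝ)
    (x : ℕ → Ω → Fin dx → ℝ) (ε : ℕ → Ω → ℝ) (γ₀ : (Fin dx → ℝ) × (Fin dz → ℝ)) (τ₀ : ℝ)
    (T : ℕ) (θ : Param dx dz) (τ : ℝ) : ℝ :=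
  ∫ ω, Real.log (normalLik R T (response R x ε γ₀ τ₀ T ω) (fun t => x t ω) θ τ) ∂μ

/-- `θ` minimizes, among all parameters with positive variance, the Kullback-Leibler divergence
per observation, as `T → ∞`, of the model with break `τ` from the data generating process. The
divergences of two parameters differ by the difference of their expected log likelihoods, which
is meaningful also when the errors have no density. -/
def IsPseudoTrue {dx dz : ℕ} (μ : Measure Ω) (R : Matrix (Fin dx) (Fin dz) ℝ)
    (x : ℕ → Ω → Fin dx → ℝ) (ε : ℕ → Ω → ℝ) (γ₀ : (Fin dx → ℝ) × (Fin dz → ℝ)) (τ₀ τ : ℝ)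
    (θ : Param dx dz) : Prop :=
  0 < θ.2 ∧ ∀ θ' : Param dx dz, 0 < θ'.2 → ∃ d : ℝ, 0 ≤ d ∧
    Tendsto (fun T : ℕ => (1 / (T : ℝ)) *
      (meanLogLik μ R x ε γ₀ τ₀ T θ τ - meanLogLik μ R x ε γ₀ τ₀ T θ' τ)) atTop (𝓝 d)

/-- The pseudo true parameter value `θ*(τ)`. -/
def pseudoTrue {dx dz : ℕ} (μ : Measure Ω) (R : Matrix (Fin dx) (Fin dz) ℝ)
    (x : ℕ → Ω → Fin dx → ℝ) (ε : ℕ → Ω → ℝ) (γ₀ : (Fin dx → ℝ) × (Fin dz → ℝ)) (τ₀ τ : ℝ) :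
    Param dx dz :=
  Classical.epsilon (IsPseudoTrue μ R x ε γ₀ τ₀ τ)

end Probability

/-- The assumptions on the parameter space `Θ` and on the joint prior density of `(θ, τ)`, where
`θstar τ` is the pseudo true parameter for the break `τ`. -/
structure RegularPrior {dx dz : ℕ} (Θ : Set (Param dx dz)) (H : Set ℝ)
    (prior : Param dx dz × ℝ → ℝ) (θstar : ℝ → Param dx dz) : Prop where
  compact : IsCompact Θ
  convex : Convex ℝ Θ
  variance_pos : ∀ θ ∈ Θ, 0 < θ.2
  star_mem : ∀ τ ∈ H, θstar τ ∈ interior Θ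
  measurable : Measurable prior
  nonneg : ∀ p, 0 ≤ prior p
  total_mass : ∫ p, prior p = 1
  supported : ∀ p, p ∉ Θ ×ˢ H → prior p = 0
  /-- Near `(θ*(τ), τ)` the prior is continuous in `θ` and bounded away from `0` and `∞`. -/
  regular : ∀ τ ∈ H, ∃ W ∈ 𝓝 (θstar τ, τ),
    (∀ s ∈ H, ContinuousOn (fun θ => prior (θ, s)) {θ | θ ∈ Θ ∧ (θ, s) ∈ W}) ∧
    ∃ c C : ℝ, 0 < c ∧ ∀ p ∈ W ∩ Θ ×ˢ H, c ≤ prior p ∧ prior p ≤ C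

end BreakModel

end

/-! The log likelihood ratio of `(θ, τ)` against the truth is a combination of second moments
summed over blocks of dates. The maximal ergodic inequality, applied to averages over long blocks,
makes the law of large numbers for these moments uniform over all windows that end or start at the
break, up to the error made on windows of bounded length. Misplacing the break costs a quadratic
form of the jump at every date of the window between the two breaks: near the truth, moving the
break from `τ₀` to `τ` changes the log likelihood by at most `K - a * T * |τ - τ₀|`, while for
remote `θ` or `τ` the log likelihood ratio against the truth is at most `-3 * ζ * T`. Let `Z` be
the likelihood at `τ₀`, integrated over the parameters near the truth. Breaks within `1 / T` of
`τ₀` keep the evidence above a multiple of `Z / T`, whereas the breaks outside `(τ₀ - m / T, τ₀ +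
m / T)` contribute at most a multiple of `exp (-a * m / 2) * Z / T` and an exponentially small
multiple of `Z`. -/

noncomputable section

namespace BreakModel

section MaximalInequality

/-- The largest of the partial sums `0, a 0, a 0 + a 1, …` with at most `n` terms, the functional
behind the maximal ergodic inequality. -/
def maxPartialSum (a : ℕ → ℝ) (n : ℕ) : ℝ :=
  partialSups (fun m => ∑ s ∈ Finset.range m, a s) n

lemma sum_le_maxPartialSum (a : ℕ → ℝ) {m n : ℕ} (hmn : m ≤ n) :
    ∑ s ∈ Finset.range m, a s ≤ maxPartialSum a n :=
  le_partialSups_of_le (fun m => ∑ s ∈ Finset.range m, a s) hmn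

lemma exists_maxPartialSum_eq (a : ℕ → ℝ) (n : ℕ) :
    ∃ m ≤ n, maxPartialSum a n = ∑ s ∈ Finset.range m, a s := by
  obtain ⟨m, hm, h⟩ := Finset.exists_mem_eq_sup' (Finset.nonempty_range_add_one (n := n))
    (fun m => ∑ s ∈ Finset.range m, a s)
  exact ⟨m, Finset.mem_range_succ_iff.mp hm, (partialSups_eq_sup'_range _ n).trans h⟩

lemma maxPartialSum_nonneg (a : ℕ → ℝ) (n : ℕ) : 0 ≤ maxPartialSum a n := by
  simpa using sum_le_maxPartialSum a (Nat.zero_le n)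

lemma maxPartialSum_zero (a : ℕ → ℝ) : maxPartialSum a 0 = 0 := by simp [maxPartialSum]

lemma maxPartialSum_succ (a : ℕ → ℝ) (n : ℕ) :
    maxPartialSum a (n + 1) = max (maxPartialSum a n) (∑ s ∈ Finset.range (n + 1), a s) :=
  partialSups_add_one _ _

lemma dependsOn_maxPartialSum (n : ℕ) : DependsOn (maxPartialSum · n) (Iio n) := by
  refine fun a b hab => eq_of_forall_ge_iff fun c => ?_
  simp only [maxPartialSum, partialSups_le_iff]
  refine forall₂_congr fun m hm => ?_
  rw [Finset.sum_congr rfl fun s hs => hab s ((Finset.mem_range.mp hs).trans_le hm)]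

lemma measurable_maxPartialSum (n : ℕ) : Measurable (maxPartialSum · n) := by
  induction n with
  | zero => simp only [maxPartialSum_zero, measurable_const]
  | succ n ih =>
    simp only [maxPartialSum_succ]
    exact ih.max (Finset.measurable_sum _ fun s _ => measurable_pi_apply s)

lemma maxPartialSum_sub_shift_le (a : ℕ → ℝ) (n : ℕ) :
    maxPartialSum a n - maxPartialSum (fun t => a (t + 1)) n
      ≤ if 0 < maxPartialSum a n then a 0 else 0 := by
  split_ifs with hpos
  · obtain ⟨m, hmn, hm⟩ := exists_maxPartialSum_eq a n
    cases m with
    | zero => simp [hm] at hpos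
    | succ m =>
      have hshift := sum_le_maxPartialSum (fun t => a (t + 1)) (Nat.le_of_succ_le hmn)
      rw [hm, Finset.sum_range_succ']
      linarith
  · linarith [maxPartialSum_nonneg (fun t => a (t + 1)) n]

variable {Ω : Type*} [MeasurableSpace Ω] {μ : Measure Ω}

lemma integrable_maxPartialSum {h : ℕ → Ω → ℝ} (hi : ∀ t, Integrable (h t) μ) (n : ℕ) :
    Integrable (fun ω => maxPartialSum (fun s => h s ω) n) μ := by
  induction n with
  | zero =>
    simp only [maxPartialSum_zero]
    exact integrable_zero Ω ℝ μ
  | succ n ih =>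
    simp only [maxPartialSum_succ]
    exact ih.sup (integrable_finsetSum _ fun s _ => hi s)

/-- The first `N` terms of a sequence have the same joint law as the `N` terms that follow the
initial one. Only finitely many terms are compared, because a stationary sequence read backwards
from the date `n` has this property for `N < n` only. -/
def ShiftInvariant (μ : Measure Ω) (h : ℕ → Ω → ℝ) (N : ℕ) : Prop :=
  IdentDistrib (fun ω (t : Fin N) => h (t + 1) ω) (fun ω (t : Fin N) => h t ω) μ μ

lemma ShiftInvariant.comp {β : Type*} [MeasurableSpace β] {h : ℕ → Ω → ℝ} {N : ℕ}
    (hs : ShiftInvariant μ h N) {F : (ℕ → ℝ) → β} (hF : Measurable F) (hN : DependsOn F (Iio N)) :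
    IdentDistrib (fun ω => F fun t => h (t + 1) ω) (fun ω => F fun t => h t ω) μ μ := by
  set extend : (Fin N → ℝ) → ℕ → ℝ := fun a t => if ht : t < N then a ⟨t, ht⟩ else 0
  have hextend : Measurable extend := measurable_pi_iff.mpr fun t => by
    by_cases ht : t < N
    · simpa only [extend, ht, dite_true] using measurable_pi_apply _
    · simpa only [extend, ht, dite_false] using measurable_const
  have hF_extend : ∀ a : ℕ → ℝ, F (extend fun t => a t) = F a := fun a =>
    hN fun t ht => by simp only [extend, mem_Iio.mp ht, dite_true]
  convert IdentDistrib.comp hs (hF.comp hextend) using 2 with ω ω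
  · exact (hF_extend fun t => h (t + 1) ω).symm
  · exact (hF_extend fun t => h t ω).symm

lemma ShiftInvariant.integral_pos_maxPartialSum_nonneg {a : ℕ → Ω → ℝ} {N : ℕ}
    (hm : ∀ t, Measurable (a t)) (hi : ∀ t, Integrable (a t) μ) (hs : ShiftInvariant μ a N) :
    0 ≤ ∫ ω in {ω | 0 < maxPartialSum (fun t => a t ω) N}, a 0 ω ∂μ := by
  have hpos_meas : MeasurableSet {ω | 0 < maxPartialSum (fun t => a t ω) N} :=
    measurableSet_lt measurable_const
      ((measurable_maxPartialSum N).comp (measurable_pi_iff.mpr hm))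
  have hint := integrable_maxPartialSum hi N
  have hint_shift := integrable_maxPartialSum (fun t => hi (t + 1)) N
  have hsame := (hs.comp (measurable_maxPartialSum N) (dependsOn_maxPartialSum N)).integral_eq
  calc (0 : ℝ)
      = ∫ ω, (maxPartialSum (fun t => a t ω) N - maxPartialSum (fun t => a (t + 1) ω) N) ∂μ := by
        rw [integral_sub hint hint_shift, hsame, sub_self]
    _ ≤ ∫ ω, {ω | 0 < maxPartialSum (fun t => a t ω) N}.indicator (a 0) ω ∂μ :=
        integral_mono (hint.sub hint_shift) ((hi 0).indicator hpos_meas) fun ω => by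
          simpa only [indicator, mem_ofPred_eq] using maxPartialSum_sub_shift_le (a · ω) N
    _ = _ := integral_indicator hpos_meas

lemma ShiftInvariant.measureReal_exists_lt_abs_sum_le [IsFiniteMeasure μ] {h : ℕ → Ω → ℝ} {N : ℕ}
    (hm : ∀ t, Measurable (h t)) (hi : ∀ t, Integrable (h t) μ) (hs : ShiftInvariant μ h N)
    {c : ℝ} (hc : 0 < c) :
    μ.real {ω | ∃ m ≤ N, c * m < |∑ t ∈ Finset.range m, h t ω|} ≤ (∫ ω, |h 0 ω| ∂μ) / c := by
  set a : ℕ → Ω → ℝ := fun t ω => |h t ω| - c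
  set E : Set Ω := {ω | 0 < maxPartialSum (fun t => a t ω) N}
  have hs_a : ShiftInvariant μ a N :=
    IdentDistrib.comp hs (u := fun (b : Fin N → ℝ) t => |b t| - c) (by fun_prop)
  have hmaximal : 0 ≤ ∫ ω in E, a 0 ω ∂μ := hs_a.integral_pos_maxPartialSum_nonneg
    (fun t => (hm t).abs.sub_const c) fun t => (hi t).abs.sub (integrable_const c)
  have hE : c * μ.real E ≤ ∫ ω, |h 0 ω| ∂μ := by
    rw [integral_sub (hi 0).abs.integrableOn (integrable_const c), setIntegral_const,
      smul_eq_mul] at hmaximal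
    linarith [setIntegral_le_integral (s := E) (hi 0).abs (ae_of_all _ fun ω => abs_nonneg _)]
  rw [le_div_iff₀' hc]
  refine (mul_le_mul_of_nonneg_left (measureReal_mono ?_) hc.le).trans hE
  rintro ω ⟨m, hmN, hlt⟩
  have hsum := sum_le_maxPartialSum (fun t => a t ω) hmN
  simp only [a, Finset.sum_sub_distrib, Finset.sum_const, Finset.card_range,
    nsmul_eq_mul] at hsum
  have := Finset.abs_sum_le_sum_abs (fun t => h t ω) (Finset.range m)
  change 0 < maxPartialSum (fun t => a t ω) N
  linarith

end MaximalInequality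

section BlockMeans

lemma sum_range_add_sub (a : ℕ → ℝ) (m s : ℕ) :
    ∑ t ∈ Finset.range m, a (t + s) - ∑ t ∈ Finset.range m, a t
      = ∑ t ∈ Finset.range s, a (m + t) - ∑ t ∈ Finset.range s, a t := by
  have hms := Finset.sum_range_add a m s
  have hsm := Finset.sum_range_add a s m
  simp only [add_comm s] at hsm
  linarith

lemma sum_range_blockMean_sub_sum (a : ℕ → ℝ) {K : ℕ} (hK : K ≠ 0) (m : ℕ) :
    ∑ t ∈ Finset.range m, (∑ s ∈ Finset.range K, a (t + s)) / K - ∑ t ∈ Finset.range m, a t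
      = (∑ s ∈ Finset.range K,
        (∑ t ∈ Finset.range s, a (m + t) - ∑ t ∈ Finset.range s, a t)) / K := by
  simp only [← sum_range_add_sub a m]
  rw [← Finset.sum_div, Finset.sum_comm, Finset.sum_sub_distrib, sub_div]
  simp only [Finset.sum_const, Finset.card_range, nsmul_eq_mul]
  field_simp

lemma abs_sum_range_le_mul {a : ℕ → ℝ} {b : ℝ} {s : ℕ} (ha : ∀ t < s, |a t| ≤ b) :
    |∑ t ∈ Finset.range s, a t| ≤ s * b := by
  simpa using (Finset.abs_sum_le_sum_abs a _).trans
    (Finset.sum_le_sum fun t ht => ha t (Finset.mem_range.mp ht))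

lemma abs_sum_blockMean_sub_sum_le {a : ℕ → ℝ} {c : ℝ} (hc : 0 ≤ c) {m M K : ℕ} (hK : K ≠ 0)
    (hKM : K ≤ M) (ha : ∀ t, |a t| ≤ c * (t + M)) :
    |∑ t ∈ Finset.range m, (∑ s ∈ Finset.range K, a (t + s)) / K - ∑ t ∈ Finset.range m, a t|
      ≤ 4 * K * c * (m + M) := by
  have hboundary : ∀ s < K,
      |∑ t ∈ Finset.range s, a (m + t) - ∑ t ∈ Finset.range s, a t| ≤ 4 * K * c * (m + M) := by
    intro s hs
    have hsK : (s : ℝ) ≤ K := by exact_mod_cast hs.le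
    have : (0 : ℝ) ≤ m := Nat.cast_nonneg m
    have htM : ∀ t < s, (t : ℝ) ≤ M := fun t ht => by exact_mod_cast (by omega : t ≤ M)
    have hlast : |∑ t ∈ Finset.range s, a (m + t)| ≤ s * (2 * c * (m + M)) :=
      abs_sum_range_le_mul fun t ht => (ha (m + t)).trans <| by
        push_cast
        nlinarith [htM t ht]
    have hfirst : |∑ t ∈ Finset.range s, a t| ≤ s * (2 * c * (m + M)) :=
      abs_sum_range_le_mul fun t ht => (ha t).trans <| by nlinarith [htM t ht]
    calc |∑ t ∈ Finset.range s, a (m + t) - ∑ t ∈ Finset.range s, a t|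
        ≤ s * (2 * c * (m + M)) + s * (2 * c * (m + M)) :=
          (abs_sub _ _).trans (add_le_add hlast hfirst)
      _ = 4 * s * c * (m + M) := by ring
      _ ≤ 4 * K * c * (m + M) := by gcongr
  rw [sum_range_blockMean_sub_sum a hK, abs_div, Nat.abs_cast, div_le_iff₀ (by positivity),
    mul_comm]
  exact abs_sum_range_le_mul hboundary

variable {Ω : Type*} [MeasurableSpace Ω] {μ : Measure Ω}

/-- The average of the `K` consecutive terms `h t, …, h (t + K - 1)`; a long average replaces a
single term in the proof of the uniform law of large numbers. -/
def blockMean (h : ℕ → Ω → ℝ) (K t : ℕ) (ω : Ω) : ℝ :=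
  (∑ s ∈ Finset.range K, h (t + s) ω) / K

lemma measurable_blockMean {h : ℕ → Ω → ℝ} (hm : ∀ t, Measurable (h t)) (K t : ℕ) :
    Measurable (blockMean h K t) :=
  (Finset.measurable_sum _ fun s _ => hm (t + s)).div_const _

lemma integrable_blockMean {h : ℕ → Ω → ℝ} (hi : ∀ t, Integrable (h t) μ) (K t : ℕ) :
    Integrable (blockMean h K t) μ :=
  (integrable_finsetSum _ fun s _ => hi (t + s)).div_const _

lemma ShiftInvariant.blockMean {h : ℕ → Ω → ℝ} {N K : ℕ} (hs : ShiftInvariant μ h (N + K)) :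
    ShiftInvariant μ (blockMean h K) N := by
  have hcomp := hs.comp
    (F := fun a (t : Fin N) => (∑ s ∈ Finset.range K, a (t + s)) / K) (by fun_prop)
    fun a b hab => funext fun t => congrArg (· / (K : ℝ)) <| Finset.sum_congr rfl fun s hs =>
      hab (t + s) <| add_lt_add t.isLt (Finset.mem_range.mp hs)
  simpa only [ShiftInvariant, BreakModel.blockMean, add_right_comm] using hcomp

/-- The tail of the convergent series `∑ P(|X| > j)` bounds the probability, uniformly over the
sequences with the marginal law of `X`. -/
lemma eventually_measureReal_exists_lt_abs_le [IsProbabilityMeasure μ] {X : Ω → ℝ}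
    (hX : Integrable X μ) {c e : ℝ} (hc : 0 < c) (he : 0 < e) :
    ∀ᶠ M : ℕ in atTop, ∀ h : ℕ → Ω → ℝ, (∀ t, IdentDistrib (h t) X μ μ) →
      μ.real {ω | ∃ t : ℕ, c * (t + M) < |h t ω|} ≤ e := by
  have hsummable : ∑' j : ℕ, μ {ω | |X ω| / c ∈ Ioi (j : ℝ)} ≠ ⊤ := by
    let _ : MeasureSpace Ω := ⟨μ⟩
    exact (tsum_prob_mem_Ioi_lt_top (hX.abs.div_const c)
      fun ω => div_nonneg (abs_nonneg _) hc.le).ne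
  filter_upwards [(ENNReal.tendsto_sum_nat_add _ hsummable).eventually_le_const
    (ENNReal.ofReal_pos.mpr he)] with M hM h hh
  refine ENNReal.toReal_le_of_le_ofReal he.le (le_trans ?_ hM)
  have hunion : {ω | ∃ t : ℕ, c * (t + M) < |h t ω|}
      = ⋃ t : ℕ, {ω | |h t ω| / c ∈ Ioi ((t + M : ℕ) : ℝ)} := by
    ext ω
    simp only [mem_ofPred_eq, mem_iUnion, mem_Ioi, lt_div_iff₀' hc, Nat.cast_add]
  rw [hunion]
  refine (measure_iUnion_le _).trans_eq (tsum_congr fun t => ?_)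
  exact ((hh t).comp (u := fun y => |y| / c) (by fun_prop)).measure_mem_eq measurableSet_Ioi

end BlockMeans

section Stationary

variable {Ω : Type*} [MeasurableSpace Ω] {μ : Measure Ω}

lemma identDistrib_shift {E : Type*} [MeasurableSpace E] {Y : ℕ → Ω → E}
    (hY : ∀ t, Measurable (Y t))
    (hs : IdentDistrib (fun ω (t : ℕ) => Y (t + 1) ω) (fun ω (t : ℕ) => Y t ω) μ μ) (k : ℕ) :
    IdentDistrib (fun ω (t : ℕ) => Y (t + k) ω) (fun ω (t : ℕ) => Y t ω) μ μ := by
  induction k with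
  | zero => exact IdentDistrib.refl (measurable_pi_iff.mpr hY).aemeasurable
  | succ k ih =>
    have hstep : IdentDistrib (fun ω (t : ℕ) => Y (t + (k + 1)) ω)
        (fun ω (t : ℕ) => Y (t + k) ω) μ μ :=
      hs.comp (u := fun (y : ℕ → E) (t : ℕ) => y (t + k)) (by fun_prop)
    exact hstep.trans ih

lemma identDistrib_of_shift {E : Type*} [MeasurableSpace E] {Y : ℕ → Ω → E}
    (hY : ∀ t, Measurable (Y t))
    (hs : IdentDistrib (fun ω (t : ℕ) => Y (t + 1) ω) (fun ω (t : ℕ) => Y t ω) μ μ) (t : ℕ) :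
    IdentDistrib (Y t) (Y 0) μ μ := by
  simpa only [Function.comp_def, zero_add] using
    (identDistrib_shift hY hs t).comp (u := fun y : ℕ → E => y 0) (measurable_pi_apply 0)

lemma identDistrib_blockMean {f : ℕ → Ω → ℝ} (hf : ∀ t, Measurable (f t))
    (hs : IdentDistrib (fun ω (t : ℕ) => f (t + 1) ω) (fun ω (t : ℕ) => f t ω) μ μ) (K k : ℕ) :
    IdentDistrib (blockMean f K k) (blockMean f K 0) μ μ := by
  convert (identDistrib_shift hf hs k).comp
    (u := fun a : ℕ → ℝ => (∑ s ∈ Finset.range K, a s) / K) (by fun_prop) using 1 <;>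
    ext ω <;> simp only [blockMean, Function.comp_def, add_comm k, zero_add]

/-- A strictly stationary integrable real sequence whose averages have arbitrarily small `L¹` norm,
the input of the uniform law of large numbers. The norm of the average of `n` terms is subadditive
up to the factor `n`, so that small averages for some lengths amount to convergence to zero. -/
structure StationaryCentred (μ : Measure Ω) (f : ℕ → Ω → ℝ) : Prop where
  measurable : ∀ t, Measurable (f t)
  stationary : IdentDistrib (fun ω (t : ℕ) => f (t + 1) ω) (fun ω (t : ℕ) => f t ω) μ μ
  integrable_zero : Integrable (f 0) μ
  exists_integral_abs_blockMean_le :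
    ∀ z : ℝ, 0 < z → ∃ K : ℕ, K ≠ 0 ∧ ∫ ω, |blockMean f K 0 ω| ∂μ ≤ z

namespace StationaryCentred

variable {f : ℕ → Ω → ℝ}

lemma identDistrib_comp {β : Type*} [MeasurableSpace β] (hf : StationaryCentred μ f) (k : ℕ)
    {F : (ℕ → ℝ) → β} (hF : Measurable F) :
    IdentDistrib (fun ω => F fun t => f (t + k) ω) (fun ω => F fun t => f t ω) μ μ :=
  (identDistrib_shift hf.measurable hf.stationary k).comp hF

lemma identDistrib_zero (hf : StationaryCentred μ f) (t : ℕ) : IdentDistrib (f t) (f 0) μ μ :=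
  identDistrib_of_shift hf.measurable hf.stationary t

lemma integrable (hf : StationaryCentred μ f) (t : ℕ) : Integrable (f t) μ :=
  (hf.identDistrib_zero t).integrable_iff.mpr hf.integrable_zero

lemma integral_eq_zero (hf : StationaryCentred μ f) (t : ℕ) : ∫ ω, f t ω ∂μ = 0 := by
  refine abs_eq_zero.mp (le_antisymm (le_of_forall_pos_le_add fun z hz => ?_) (abs_nonneg _))
  obtain ⟨K, hK, hKz⟩ := hf.exists_integral_abs_blockMean_le z hz
  have hmean : ∫ ω, blockMean f K 0 ω ∂μ = ∫ ω, f t ω ∂μ := by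
    simp only [blockMean]
    rw [integral_div, integral_finsetSum _ fun s _ => hf.integrable (0 + s),
      Finset.sum_congr rfl fun s _ =>
        ((hf.identDistrib_zero (0 + s)).trans (hf.identDistrib_zero t).symm).integral_eq,
      Finset.sum_const, Finset.card_range, nsmul_eq_mul]
    field_simp
  rw [← hmean, zero_add]
  exact abs_integral_le_integral_abs.trans hKz

lemma shiftInvariant_forward (hf : StationaryCentred μ f) (n N : ℕ) :
    ShiftInvariant μ (fun t => f (n + t)) N := by
  have hshift (k : ℕ) := hf.identDistrib_comp k (F := fun a (t : Fin N) => a t) (by fun_prop)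
  simpa only [ShiftInvariant, add_comm n, add_assoc, add_left_comm 1 n]
    using (hshift (n + 1)).trans (hshift n).symm

lemma shiftInvariant_backward (hf : StationaryCentred μ f) {n N : ℕ} (hN : N < n) :
    ShiftInvariant μ (fun t => f (n - 1 - t)) N := by
  have hshift := hf.identDistrib_comp 1
    (F := fun a (t : Fin N) => a (n - 1 - (t + 1))) (by fun_prop)
  have hindex (t : Fin N) : n - 1 - (t + 1) + 1 = n - 1 - t := by omega
  simpa only [ShiftInvariant, hindex] using hshift.symm

lemma identDistrib_blockMean_backward (hf : StationaryCentred μ f) {n K : ℕ} (hK : K ≤ n) :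
    IdentDistrib (blockMean (fun t => f (n - 1 - t)) K 0) (blockMean f K 0) μ μ := by
  convert identDistrib_blockMean hf.measurable hf.stationary K (n - K) using 1
  funext ω
  simp only [blockMean, zero_add]
  rw [← Finset.sum_range_reflect]
  refine congrArg (· / (K : ℝ)) (Finset.sum_congr rfl fun s hs => ?_)
  have := Finset.mem_range.mp hs
  rw [show n - 1 - (K - 1 - s) = n - K + s by omega]

variable [IsProbabilityMeasure μ]

lemma exists_eventually_window_bound (hf : StationaryCentred μ f) {c e : ℝ} (hc : 0 < c)
    (he : 0 < e) : ∃ K : ℕ, ∀ᶠ M : ℕ in atTop, ∀ (u : ℕ → ℕ) (N : ℕ),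
      ShiftInvariant μ (fun t => f (u t)) (N + K) →
      IdentDistrib (blockMean (fun t => f (u t)) K 0) (blockMean f K 0) μ μ →
      μ.real {ω | ∃ m ≤ N, c * (m + M) < |∑ t ∈ Finset.range m, f (u t) ω|} ≤ e := by
  obtain ⟨K, hK, hblock⟩ := hf.exists_integral_abs_blockMean_le (e / 2 * (c / 2)) (by positivity)
  refine ⟨K, ?_⟩
  set c' : ℝ := c / (8 * K)
  have hc' : 0 < c' := by positivity
  filter_upwards [eventually_measureReal_exists_lt_abs_le hf.integrable_zero hc' (half_pos he),
    eventually_ge_atTop K] with M hterms hKM u N hs hident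
  set h : ℕ → Ω → ℝ := fun t => f (u t)
  have hblocks : μ.real {ω | ∃ m ≤ N, c / 2 * m < |∑ t ∈ Finset.range m, blockMean h K t ω|}
      ≤ e / 2 := by
    refine (hs.blockMean.measureReal_exists_lt_abs_sum_le
      (measurable_blockMean (fun t => hf.measurable _) K)
      (integrable_blockMean (fun t => hf.integrable _) K) (half_pos hc)).trans
      ((div_le_iff₀ (half_pos hc)).mpr ?_)
    exact (hident.comp measurable_norm).integral_eq.trans_le hblock
  refine (measureReal_mono ?_).trans ((measureReal_union_le _ _).trans
    ((add_le_add hblocks (hterms h fun t => hf.identDistrib_zero _)).trans_eq (add_halves e)))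
  rintro ω ⟨m, hmN, hlt⟩
  by_contra hgood
  simp only [mem_union, mem_ofPred_eq, not_or, not_exists, not_and, not_lt] at hgood
  have hclose := abs_sum_blockMean_sub_sum_le hc'.le (m := m) hK hKM hgood.2
  have hmean := hgood.1 m hmN
  have hconst : 4 * K * c' = c / 2 := by simp only [c']; field_simp; ring
  rw [hconst] at hclose
  have htri := abs_sub_abs_le_abs_sub (∑ t ∈ Finset.range m, h t ω)
    (∑ t ∈ Finset.range m, blockMean h K t ω)
  rw [abs_sub_comm] at htri
  have : (0 : ℝ) ≤ M := Nat.cast_nonneg M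
  simp only [blockMean, h] at hclose hmean htri
  nlinarith

lemma forward_bound (hf : StationaryCentred μ f) {c e : ℝ} (hc : 0 < c) (he : 0 < e) :
    ∀ᶠ M : ℕ in atTop, ∀ n N : ℕ,
      μ.real {ω | ∃ m ≤ N, c * (m + M) < |∑ t ∈ Finset.range m, f (n + t) ω|} ≤ e := by
  obtain ⟨K, hK⟩ := hf.exists_eventually_window_bound hc he
  filter_upwards [hK] with M hM n N
  refine hM (n + ·) N (hf.shiftInvariant_forward _ _) ?_
  convert identDistrib_blockMean hf.measurable hf.stationary K n using 1
  funext ω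
  simp only [blockMean, zero_add]

lemma backward_bound (hf : StationaryCentred μ f) {c e : ℝ} (hc : 0 < c) (he : 0 < e) :
    ∃ D : ℕ, ∀ᶠ M : ℕ in atTop, ∀ n N : ℕ, N + D ≤ n →
      μ.real {ω | ∃ m ≤ N, c * (m + M) < |∑ t ∈ Finset.range m, f (n - 1 - t) ω|} ≤ e := by
  obtain ⟨K, hK⟩ := hf.exists_eventually_window_bound hc he
  refine ⟨K + 1, ?_⟩
  filter_upwards [hK] with M hM n N hN
  exact hM (n - 1 - ·) N (hf.shiftInvariant_backward (by omega))
    (hf.identDistrib_blockMean_backward (by omega))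

lemma of_tendstoInMeasure (hm : ∀ t, Measurable (f t))
    (hs : IdentDistrib (fun ω (t : ℕ) => f (t + 1) ω) (fun ω (t : ℕ) => f t ω) μ μ)
    (hi : Integrable (f 0) μ) {u : ℕ → ℕ} (hu : Tendsto u atTop atTop)
    (hlim : TendstoInMeasure μ (fun n => blockMean f (u n) 0) atTop fun _ => 0) :
    StationaryCentred μ f := by
  refine ⟨hm, hs, hi, fun z hz => ?_⟩
  have hblock : UniformIntegrable (fun K => blockMean f K 0) 1 μ := by
    have haverage := uniformIntegrable_average_real le_rfl
      (MemLp.uniformIntegrable_of_identDistrib le_rfl ENNReal.one_ne_top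
        (memLp_one_iff_integrable.mpr hi) (identDistrib_of_shift hm hs))
    convert haverage using 2 with K
    ext ω
    simp [blockMean]
  have hL1 := tendsto_Lp_finite_of_tendstoInMeasure le_rfl ENNReal.one_ne_top
    (fun n => hblock.1 (u n)) (memLp_const 0)
    (fun e he => (hblock.2.1 he).imp fun d hd => ⟨hd.1, fun n => hd.2 (u n)⟩) hlim
  obtain ⟨n, hn, hun⟩ := ((hL1.eventually_le_const (ENNReal.ofReal_pos.mpr hz)).and
    (hu.eventually_ne_atTop 0)).exists
  refine ⟨u n, hun, ?_⟩
  rw [eLpNorm_one_eq_lintegral_enorm] at hn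
  simp only [← Real.norm_eq_abs]
  rw [integral_norm_eq_lintegral_enorm (hblock.1 (u n))]
  exact ENNReal.toReal_le_of_le_ofReal hz.le (by simpa using hn)

end StationaryCentred

end Stationary

section Moments

/-- The index of a second moment of the observation `(x_t, ε_t)`: the pair `(i, j)` for `x_i x_j`,
`i` for `x_i ε`, and the point for `ε²`. -/
abbrev MomentIndex (dx : ℕ) : Type := (Fin dx × Fin dx) ⊕ Fin dx ⊕ Unit

/-- The deviation of a second moment of the observation `(x_t, ε_t)` from its expectation when
`E[x_t x_t'] = S`, `E[x_t ε_t] = 0` and `E[ε_t²] = v`. -/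
def momentDev {dx : ℕ} (S : Matrix (Fin dx) (Fin dx) ℝ) (v : ℝ) :
    MomentIndex dx → (Fin dx → ℝ) × ℝ → ℝ
  | .inl (i, j), p => p.1 i * p.1 j - S i j
  | .inr (.inl i), p => p.1 i * p.2
  | .inr (.inr ()), p => p.2 ^ 2 - v

lemma measurable_momentDev {dx : ℕ} (S : Matrix (Fin dx) (Fin dx) ℝ) (v : ℝ) (q : MomentIndex dx) :
    Measurable (momentDev S v q) := by
  rcases q with ⟨i, j⟩ | i | ⟨⟩ <;> unfold momentDev <;> fun_prop

variable {Ω : Type*} [MeasurableSpace Ω] {μ : Measure Ω} {dx dz : ℕ} {X : Set (Fin dx → ℝ)}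
  {x : ℕ → Ω → Fin dx → ℝ} {ε : ℕ → Ω → ℝ} {δ₀ : Fin dz → ℝ} {σ₀sq : ℝ}
  {S SigmaX : Matrix (Fin dx) (Fin dx) ℝ}

/-- The part of the assumptions on the data generating process that drives posterior contraction:
the second moments of `(x_t, ε_t)` are stationary and obey a law of large numbers, with limits as
in `momentDev`. -/
structure ErgodicMoments (μ : Measure Ω) (x : ℕ → Ω → Fin dx → ℝ) (ε : ℕ → Ω → ℝ)
    (S : Matrix (Fin dx) (Fin dx) ℝ) (v : ℝ) : Prop where
  centred : ∀ q, StationaryCentred μ fun t ω => momentDev S v q (x t ω, ε t ω)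
  posDef : S.PosDef
  variance_pos : 0 < v

lemma IsBigOInProb.tendstoInMeasure [IsFiniteMeasure μ] {Y : ℕ → Ω → ℝ} {a : ℕ → ℝ}
    (hY : IsBigOInProb μ Y a) (ha : Tendsto a atTop (𝓝 0)) :
    TendstoInMeasure μ Y atTop fun _ => 0 := by
  rw [tendstoInMeasure_iff_measureReal_norm]
  intro d hd
  refine (tendsto_order.mpr ⟨fun e he => Eventually.of_forall fun T =>
    he.trans_le measureReal_nonneg, fun e he => ?_⟩)
  obtain ⟨C, -, k, hk⟩ := hY e he
  have hCa : Tendsto (fun T => C * a T) atTop (𝓝 0) := by simpa using ha.const_mul C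
  filter_upwards [eventually_ge_atTop k, hCa.eventually_lt_const hd] with T hT hsmall
  refine (measureReal_mono fun ω hω => ?_).trans_lt (hk T hT)
  exact hsmall.trans_le (by simpa using hω)

lemma tendstoInMeasure_blockMean_window [IsFiniteMeasure μ] {f : ℕ → Ω → ℝ}
    (hm : ∀ t, Measurable (f t))
    (hs : IdentDistrib (fun ω (t : ℕ) => f (t + 1) ω) (fun ω (t : ℕ) => f t ω) μ μ)
    {a b : ℕ → ℕ} {r : ℝ} (hr : 0 < r) (hab : ∀ᶠ T : ℕ in atTop, a T + r * T ≤ b T)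
    (hlim : TendstoInMeasure μ (fun (T : ℕ) ω =>
      (1 / (T : ℝ)) * ∑ t ∈ Finset.Ico (a T) (b T), f t ω) atTop fun _ => 0) :
    TendstoInMeasure μ (fun T => blockMean f (b T - a T) 0) atTop fun _ => 0 := by
  rw [tendstoInMeasure_iff_measureReal_norm] at hlim ⊢
  intro d hd
  refine squeeze_zero' (Eventually.of_forall fun T => measureReal_nonneg) ?_
    (hlim (r * d) (by positivity))
  filter_upwards [hab, eventually_gt_atTop 0] with T hT hT0
  have hident := (identDistrib_blockMean hm hs (b T - a T) (a T)).symm.measure_mem_eq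
    (s := {y | d ≤ ‖y - 0‖}) (measurableSet_le measurable_const (by fun_prop))
  refine (congrArg ENNReal.toReal hident).trans_le (measureReal_mono fun ω hω => ?_)
  have hT0' : (0 : ℝ) < T := by exact_mod_cast hT0
  have hlt : (a T : ℝ) < b T := by linarith [mul_pos hr hT0']
  have hle : a T ≤ b T := by exact_mod_cast hlt.le
  have hω' : d ≤ |∑ t ∈ Finset.Ico (a T) (b T), f t ω| / (b T - a T) := by
    rw [Finset.sum_Ico_eq_sum_range, ← Nat.cast_sub hle, ← Nat.abs_cast, ← abs_div]
    simp only [mem_preimage, mem_ofPred_eq, sub_zero] at hω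
    exact hω
  rw [mem_ofPred_eq, sub_zero, Real.norm_eq_abs, abs_mul, abs_of_pos (by positivity),
    one_div_mul_eq_div, le_div_iff₀ hT0']
  rw [le_div_iff₀ (by linarith)] at hω'
  nlinarith

lemma eventually_strictFloor_third_add_le : ∀ᶠ T : ℕ in atTop,
    (strictFloor (1 / 3 * T) : ℝ) + 1 / 6 * T ≤ strictFloor (2 / 3 * T) := by
  filter_upwards [eventually_ge_atTop 6] with T hT
  have hT' : (6 : ℝ) ≤ T := by exact_mod_cast hT
  linarith [(strictFloor_spec (a := 1 / 3 * (T : ℝ)) (by positivity)).1,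
    (strictFloor_spec (a := 2 / 3 * (T : ℝ)) (by positivity)).2]

namespace RegularDGP

lemma measurable_coord (h : RegularDGP μ X x ε δ₀ σ₀sq SigmaX) (t : ℕ) (i : Fin dx) :
    Measurable fun ω => x t ω i :=
  (measurable_pi_apply i).comp (h.measurable_x t)

lemma measurable_momentDev_comp (h : RegularDGP μ X x ε δ₀ σ₀sq SigmaX) (q : MomentIndex dx)
    (t : ℕ) : Measurable fun ω => momentDev SigmaX σ₀sq q (x t ω, ε t ω) :=
  (measurable_momentDev _ _ q).comp ((h.measurable_x t).prodMk (h.measurable_err t))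

lemma stationary_momentDev (h : RegularDGP μ X x ε δ₀ σ₀sq SigmaX) (q : MomentIndex dx) :
    IdentDistrib (fun ω (t : ℕ) => momentDev SigmaX σ₀sq q (x (t + 1) ω, ε (t + 1) ω))
      (fun ω (t : ℕ) => momentDev SigmaX σ₀sq q (x t ω, ε t ω)) μ μ :=
  h.stationary.comp (u := fun (p : ℕ → (Fin dx → ℝ) × ℝ) t => momentDev SigmaX σ₀sq q (p t))
    (measurable_pi_iff.mpr fun t => (measurable_momentDev _ _ q).comp (measurable_pi_apply t))

lemma exists_bound (h : RegularDGP μ X x ε δ₀ σ₀sq SigmaX) (t : ℕ) :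
    ∃ B : ℝ, ∀ᵐ ω ∂μ, ∀ i, |x t ω i| ≤ B := by
  obtain ⟨B, hB⟩ := h.bounded_X.exists_norm_le
  exact ⟨B, (h.x_mem t).mono fun ω hω i => (norm_le_pi_norm (x t ω) i).trans (hB _ hω)⟩

lemma integrable_coord_mul [IsProbabilityMeasure μ] (h : RegularDGP μ X x ε δ₀ σ₀sq SigmaX)
    {f : Ω → ℝ} (hf : Integrable f μ) (t : ℕ) (i : Fin dx) :
    Integrable (fun ω => x t ω i * f ω) μ := by
  obtain ⟨B, hB⟩ := h.exists_bound t
  exact hf.bdd_mul (c := B) (h.measurable_coord t i).aestronglyMeasurable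
    (hB.mono fun ω hω => hω i)

lemma integrable_coord [IsProbabilityMeasure μ] (h : RegularDGP μ X x ε δ₀ σ₀sq SigmaX)
    (t : ℕ) (i : Fin dx) : Integrable (fun ω => x t ω i) μ := by
  simpa only [mul_one] using h.integrable_coord_mul (integrable_const (1 : ℝ)) t i

lemma integral_err_sq [IsProbabilityMeasure μ] (h : RegularDGP μ X x ε δ₀ σ₀sq SigmaX) (t : ℕ) :
    ∫ ω, ε t ω ^ 2 ∂μ = σ₀sq := by
  rw [← integral_condExp (h.measurable_x t).comap_le, integral_congr_ae (h.err_condVar t)]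
  simp

lemma integrable_momentDev [IsProbabilityMeasure μ] (h : RegularDGP μ X x ε δ₀ σ₀sq SigmaX)
    (q : MomentIndex dx) (t : ℕ) :
    Integrable (fun ω => momentDev SigmaX σ₀sq q (x t ω, ε t ω)) μ := by
  rcases q with ⟨i, j⟩ | i | ⟨⟩
  · exact (h.integrable_coord_mul (h.integrable_coord t j) t i).sub (integrable_const _)
  · exact h.integrable_coord_mul ((h.err_memLp t).integrable (by norm_num)) t i
  · exact (h.err_memLp t).integrable_sq.sub (integrable_const _)

lemma tendstoInMeasure_blockMean_secondMoment [IsProbabilityMeasure μ]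
    (h : RegularDGP μ X x ε δ₀ σ₀sq SigmaX) (i j : Fin dx) :
    TendstoInMeasure μ (fun T =>
      blockMean (fun t ω => momentDev SigmaX σ₀sq (.inl (i, j)) (x t ω, ε t ω)) T 0)
      atTop fun _ => 0 := by
  rw [tendstoInMeasure_iff_measureReal_norm]
  intro d hd
  refine (tendstoInMeasure_iff_measureReal_norm.mp (h.secondMoment_plim i j) d hd).congr' ?_
  filter_upwards [eventually_ne_atTop 0] with T hT
  congr! 5 with ω
  simp only [blockMean, momentDev, zero_add, Finset.sum_sub_distrib, Finset.sum_const,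
    Finset.card_range, nsmul_eq_mul]
  field_simp
  ring

lemma tendstoInMeasure_blockMean_err_sq [IsProbabilityMeasure μ]
    (h : RegularDGP μ X x ε δ₀ σ₀sq SigmaX) :
    TendstoInMeasure μ (fun T =>
      blockMean (fun t ω => momentDev SigmaX σ₀sq (.inr (.inr ())) (x t ω, ε t ω)) T 0)
      atTop fun _ => 0 := by
  refine tendstoInMeasure_of_tendsto_ae (fun T => (measurable_blockMean
    (h.measurable_momentDev_comp _) T 0).aestronglyMeasurable) ?_
  have hident (t : ℕ) : IdentDistrib (fun ω => ε t ω ^ 2 - σ₀sq) (fun ω => ε 0 ω ^ 2 - σ₀sq) μ μ :=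
    (h.err_identDistrib t).comp (u := fun y => y ^ 2 - σ₀sq) (by fun_prop)
  have hslln := strong_law_ae_real (fun t ω => ε t ω ^ 2 - σ₀sq)
    ((h.err_memLp 0).integrable_sq.sub (integrable_const _))
    (fun s t hst => (h.err_indep.indepFun hst).comp (φ := fun y => y ^ 2 - σ₀sq)
      (ψ := fun y => y ^ 2 - σ₀sq) (by fun_prop) (by fun_prop)) hident
  have hmean : ∫ ω, (ε 0 ω ^ 2 - σ₀sq) ∂μ = 0 := by
    rw [integral_sub (h.err_memLp 0).integrable_sq (integrable_const _), h.integral_err_sq]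
    simp
  simpa only [blockMean, zero_add, momentDev, hmean] using hslln

lemma tendstoInMeasure_blockMean_coord_mul_err [IsProbabilityMeasure μ]
    (h : RegularDGP μ X x ε δ₀ σ₀sq SigmaX) (i : Fin dx) :
    TendstoInMeasure μ (fun T : ℕ =>
      blockMean (fun t ω => momentDev SigmaX σ₀sq (.inr (.inl i)) (x t ω, ε t ω))
        (strictFloor (2 / 3 * T) - strictFloor (1 / 3 * T)) 0) atTop fun _ => 0 := by
  refine tendstoInMeasure_blockMean_window (h.measurable_momentDev_comp _)
    (h.stationary_momentDev _) (show (0 : ℝ) < 1 / 6 by norm_num)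
    eventually_strictFloor_third_add_le ((h.partialSum_err (1 / 3) (2 / 3) (by norm_num)
      (by norm_num) (by norm_num) i).tendstoInMeasure ?_)
  simp only [one_div]
  exact (Real.tendsto_sqrt_atTop.comp tendsto_natCast_atTop_atTop).inv_tendsto_atTop

lemma stationaryCentred_momentDev [IsProbabilityMeasure μ]
    (h : RegularDGP μ X x ε δ₀ σ₀sq SigmaX) (q : MomentIndex dx) :
    StationaryCentred μ fun t ω => momentDev SigmaX σ₀sq q (x t ω, ε t ω) := by
  have of_tendsto {u : ℕ → ℕ} (hu : Tendsto u atTop atTop) :=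
    StationaryCentred.of_tendstoInMeasure (h.measurable_momentDev_comp q)
      (h.stationary_momentDev q) (h.integrable_momentDev q 0) hu
  rcases q with ⟨i, j⟩ | i | ⟨⟩
  · exact of_tendsto tendsto_id (h.tendstoInMeasure_blockMean_secondMoment i j)
  · refine of_tendsto ?_ (h.tendstoInMeasure_blockMean_coord_mul_err i)
    refine tendsto_natCast_atTop_iff (R := ℝ).mp (tendsto_atTop_mono' _ ?_
      (tendsto_natCast_atTop_atTop.const_mul_atTop (show (0 : ℝ) < 1 / 6 by norm_num)))
    filter_upwards [eventually_strictFloor_third_add_le] with T hT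
    have hle : strictFloor (1 / 3 * T) ≤ strictFloor (2 / 3 * T) := by
      have : (strictFloor (1 / 3 * T) : ℝ) ≤ strictFloor (2 / 3 * T) := by
        linarith [(Nat.cast_nonneg T : (0 : ℝ) ≤ T)]
      exact_mod_cast this
    rw [Nat.cast_sub hle]
    linarith
  · exact of_tendsto tendsto_id h.tendstoInMeasure_blockMean_err_sq

lemma ergodicMoments [IsProbabilityMeasure μ] (h : RegularDGP μ X x ε δ₀ σ₀sq SigmaX) :
    ErgodicMoments μ x ε SigmaX σ₀sq :=
  ⟨h.stationaryCentred_momentDev, h.secondMoment_posDef, h.variance_pos⟩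

end RegularDGP

end Moments

section SampleMoments

/-- The event of the uniform law of large numbers: the second moments are within `c` of their
expectations, relative to `T` over every initial segment of the sample of size `T`, and relative to
their own length, up to `M` dates, over the segments that start or end at the break `n₀`, those
before it having at most `κ T` dates. -/
structure SampleRegular {dx : ℕ} (S : Matrix (Fin dx) (Fin dx) ℝ) (v κ c : ℝ) (M T n₀ : ℕ)
    (x : ℕ → Fin dx → ℝ) (ε : ℕ → ℝ) : Prop where
  initial : ∀ q, ∀ n ≤ T, |∑ t ∈ Finset.range n, momentDev S v q (x t, ε t)| ≤ c * T
  after : ∀ q n, n₀ ≤ n → n ≤ T →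
    |∑ t ∈ Finset.Ico n₀ n, momentDev S v q (x t, ε t)| ≤ c * ((n - n₀ : ℕ) + M)
  before : ∀ q n, n ≤ n₀ → ((n₀ - n : ℕ) : ℝ) ≤ κ * T →
    |∑ t ∈ Finset.Ico n n₀, momentDev S v q (x t, ε t)| ≤ c * ((n₀ - n : ℕ) + M)

variable {Ω : Type*} [MeasurableSpace Ω] {μ : Measure Ω}

lemma measureReal_exists_le {ι : Type*} [Fintype ι] [Nonempty ι] {p : ι → Ω → Prop} {e : ℝ}
    (h : ∀ i, μ.real {ω | p i ω} ≤ e / Fintype.card ι) : μ.real {ω | ∃ i, p i ω} ≤ e := by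
  have hunion : {ω | ∃ i, p i ω} = ⋃ i, {ω | p i ω} := by ext ω; simp
  rw [hunion]
  refine (measureReal_iUnion_fintype_le _).trans ((Finset.sum_le_sum fun i _ => h i).trans_eq ?_)
  rw [Finset.sum_const, Finset.card_univ, nsmul_eq_mul,
    mul_div_cancel₀ _ (Nat.cast_ne_zero.mpr Fintype.card_ne_zero)]

variable [IsProbabilityMeasure μ]

namespace StationaryCentred

variable {f : ℕ → Ω → ℝ}

lemma initial_bound (hf : StationaryCentred μ f) {c e : ℝ} (hc : 0 < c) (he : 0 < e) :
    ∀ᶠ T : ℕ in atTop, μ.real {ω | ∃ n ≤ T, c * T < |∑ t ∈ Finset.range n, f t ω|} ≤ e := by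
  obtain ⟨M, hM⟩ := (hf.forward_bound (half_pos hc) he).exists
  filter_upwards [eventually_ge_atTop M] with T hT
  refine (measureReal_mono ?_).trans (hM 0 T)
  rintro ω ⟨n, hnT, hlt⟩
  refine ⟨n, hnT, lt_of_le_of_lt ?_ (by simpa using hlt)⟩
  have hnT' : (n : ℝ) ≤ T := by exact_mod_cast hnT
  have hT' : (M : ℝ) ≤ T := by exact_mod_cast hT
  nlinarith

lemma after_bound (hf : StationaryCentred μ f) {c e : ℝ} (hc : 0 < c) (he : 0 < e) :
    ∀ᶠ M : ℕ in atTop, ∀ n₀ T : ℕ, μ.real {ω | ∃ n, n₀ ≤ n ∧ n ≤ T ∧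
      c * ((n - n₀ : ℕ) + M) < |∑ t ∈ Finset.Ico n₀ n, f t ω|} ≤ e := by
  filter_upwards [hf.forward_bound hc he] with M hM n₀ T
  refine (measureReal_mono ?_).trans (hM n₀ T)
  rintro ω ⟨n, -, hnT, hlt⟩
  exact ⟨n - n₀, (Nat.sub_le _ _).trans hnT, by rwa [Finset.sum_Ico_eq_sum_range] at hlt⟩

lemma before_bound (hf : StationaryCentred μ f) {c e : ℝ} (hc : 0 < c) (he : 0 < e) :
    ∃ D : ℕ, ∀ᶠ M : ℕ in atTop, ∀ n₀ N : ℕ, N + D ≤ n₀ → μ.real {ω | ∃ n, n ≤ n₀ ∧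
      n₀ - n ≤ N ∧ c * ((n₀ - n : ℕ) + M) < |∑ t ∈ Finset.Ico n n₀, f t ω|} ≤ e := by
  obtain ⟨D, hD⟩ := hf.backward_bound hc he
  refine ⟨D, ?_⟩
  filter_upwards [hD] with M hM n₀ N hN
  refine (measureReal_mono ?_).trans (hM n₀ N hN)
  rintro ω ⟨n, hn, hnN, hlt⟩
  refine ⟨n₀ - n, hnN, hlt.trans_eq (congrArg abs ?_)⟩
  rw [Finset.sum_Ico_eq_sum_range, ← Finset.sum_range_reflect]
  refine Finset.sum_congr rfl fun t ht => congrArg (f · ω) ?_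
  have := Finset.mem_range.mp ht
  omega

end StationaryCentred

variable {dx : ℕ} {x : ℕ → Ω → Fin dx → ℝ} {ε : ℕ → Ω → ℝ} {S : Matrix (Fin dx) (Fin dx) ℝ} {v : ℝ}

lemma ErgodicMoments.exists_sampleRegular (h : ErgodicMoments μ x ε S v) {τ₀ κ c e : ℝ}
    (hκ : 0 < κ) (hκτ : κ < τ₀) (hc : 0 < c) (he : 0 < e) : ∃ M : ℕ, ∀ᶠ T : ℕ in atTop,
      μ.real {ω | ¬ SampleRegular S v κ c M T (strictFloor (τ₀ * T)) (fun t => x t ω)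
        (fun t => ε t ω)} ≤ e := by
  have heN : 0 < e / 3 / Fintype.card (MomentIndex dx) := by positivity
  choose D hD using fun q => (h.centred q).before_bound hc heN
  obtain ⟨M, hafter, hbefore⟩ := ((eventually_all.mpr fun q =>
    (h.centred q).after_bound hc heN).and (eventually_all.mpr hD)).exists
  refine ⟨M, ?_⟩
  have hlim : Tendsto (fun T : ℕ => (τ₀ - κ) * (T : ℝ)) atTop atTop :=
    tendsto_natCast_atTop_atTop.const_mul_atTop (sub_pos.mpr hκτ)
  filter_upwards [eventually_all.mpr fun q => (h.centred q).initial_bound hc heN,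
    eventually_all.mpr fun q => hlim.eventually_ge_atTop (D q + 1), eventually_gt_atTop 0]
    with T hinitial hroom hT
  have hT' : (0 : ℝ) < T := by exact_mod_cast hT
  set n₀ := strictFloor (τ₀ * T)
  have hroom' (q : MomentIndex dx) : ⌊κ * T⌋₊ + D q ≤ n₀ := by
    have : (⌊κ * T⌋₊ + D q : ℝ) ≤ n₀ := by
      linarith [hroom q, Nat.floor_le (show 0 ≤ κ * T by positivity),
        (strictFloor_spec (mul_pos (hκ.trans hκτ) hT')).2]
    exact_mod_cast this
  refine (measureReal_mono ?_).trans (((measureReal_union_le _ _).trans (add_le_add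
    (measureReal_exists_le hinitial) ((measureReal_union_le _ _).trans (add_le_add
      (measureReal_exists_le fun q => hafter q n₀ T)
      (measureReal_exists_le fun q => hbefore q n₀ ⌊κ * T⌋₊ (hroom' q)))))).trans_eq (by ring))
  intro ω hω
  by_contra hgood
  simp only [mem_union, mem_ofPred_eq, not_or, not_exists, not_and, not_lt] at hgood
  exact hω ⟨hgood.1, hgood.2.1, fun q n hn hnκ => hgood.2.2 q n hn (Nat.le_floor hnκ)⟩

end SampleMoments

section Expansion

variable {dx dz : ℕ}

/-- The quadratic form `w' S w`. -/
def quadForm (S : Matrix (Fin dx) (Fin dx) ℝ) (w : Fin dx → ℝ) : ℝ :=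
  w ⬝ᵥ S *ᵥ w

/-- The coefficients of the squared residual `(ε - x' w)²` as a combination of the second moments
of `(x, ε)`. -/
def resWeight (w : Fin dx → ℝ) : MomentIndex dx → ℝ
  | .inl (i, j) => w i * w j
  | .inr (.inl i) => -2 * w i
  | .inr (.inr ()) => 1

/-- The error in the coefficient of `x_t`, where `a` and `a₀` tell whether the date `t` lies after
the break of the model and after the true break. -/
def coefDev (R : Matrix (Fin dx) (Fin dz) ℝ) (γ₀ γ : (Fin dx → ℝ) × (Fin dz → ℝ)) (a a₀ : Bool) :
    Fin dx → ℝ :=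
  γ.1 - γ₀.1 + (if a then R *ᵥ γ.2 else 0) - if a₀ then R *ᵥ γ₀.2 else 0

/-- The residual sum of squares of the model with slopes `γ` and break after `n` dates, when the
true slopes are `γ₀` and the true break is after `n₀` dates. -/
def rss (R : Matrix (Fin dx) (Fin dz) ℝ) (T n₀ : ℕ) (γ₀ : (Fin dx → ℝ) × (Fin dz → ℝ))
    (x : ℕ → Fin dx → ℝ) (ε : ℕ → ℝ) (γ : (Fin dx → ℝ) × (Fin dz → ℝ)) (n : ℕ) : ℝ :=
  ∑ t ∈ Finset.range T, (ε t - x t ⬝ᵥ coefDev R γ₀ γ (n ≤ t) (n₀ ≤ t)) ^ 2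

/-- The log likelihood of the parameter `θ` and a break after `n` dates. -/
def logLik (R : Matrix (Fin dx) (Fin dz) ℝ) (T n₀ : ℕ) (γ₀ : (Fin dx → ℝ) × (Fin dz → ℝ))
    (x : ℕ → Fin dx → ℝ) (ε : ℕ → ℝ) (θ : Param dx dz) (n : ℕ) : ℝ :=
  -(T / 2 * Real.log (2 * Real.pi * θ.2)) - rss R T n₀ γ₀ x ε θ.1 n / (2 * θ.2)

/-- The expectation of `logLik` when `E[x_t x_t'] = S`, `E[x_t ε_t] = 0` and `E[ε_t²] = v`. -/
def expLogLik (S : Matrix (Fin dx) (Fin dx) ℝ) (v : ℝ) (R : Matrix (Fin dx) (Fin dz) ℝ)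
    (T n₀ : ℕ) (γ₀ : (Fin dx → ℝ) × (Fin dz → ℝ)) (θ : Param dx dz) (n : ℕ) : ℝ :=
  -(T / 2 * Real.log (2 * Real.pi * θ.2)) - (∑ t ∈ Finset.range T,
    (quadForm S (coefDev R γ₀ θ.1 (n ≤ t) (n₀ ≤ t)) + v)) / (2 * θ.2)

lemma quadForm_eq_sum (S : Matrix (Fin dx) (Fin dx) ℝ) (w : Fin dx → ℝ) :
    quadForm S w = ∑ i, ∑ j, w i * w j * S i j := by
  simp only [quadForm, dotProduct, Matrix.mulVec, Finset.mul_sum]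
  exact Finset.sum_congr rfl fun i _ => Finset.sum_congr rfl fun j _ => by ring

lemma sq_residual_eq (S : Matrix (Fin dx) (Fin dx) ℝ) (v : ℝ) (w x : Fin dx → ℝ) (ε : ℝ) :
    (ε - x ⬝ᵥ w) ^ 2 = quadForm S w + v + ∑ q, resWeight w q * momentDev S v q (x, ε) := by
  have hsq : (x ⬝ᵥ w) ^ 2 = ∑ i, ∑ j, w i * w j * (x i * x j) := by
    simp only [dotProduct, sq, Finset.sum_mul_sum]
    exact Finset.sum_congr rfl fun i _ => Finset.sum_congr rfl fun j _ => by ring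
  have hcross : 2 * (ε * (x ⬝ᵥ w)) = ∑ i, 2 * w i * (x i * ε) := by
    simp only [dotProduct, Finset.mul_sum]
    exact Finset.sum_congr rfl fun i _ => by ring
  simp only [Fintype.sum_sum_type, Fintype.sum_prod_type, Fintype.sum_unique, resWeight, momentDev,
    mul_sub, Finset.sum_sub_distrib, quadForm_eq_sum, neg_mul, Finset.sum_neg_distrib]
  linear_combination hsq - hcross

lemma continuous_quadForm (S : Matrix (Fin dx) (Fin dx) ℝ) : Continuous (quadForm S) := by
  unfold quadForm
  fun_prop

lemma continuous_resWeight (q : MomentIndex dx) : Continuous fun w => resWeight w q := by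
  rcases q with ⟨i, j⟩ | i | ⟨⟩ <;> simp only [resWeight] <;> fun_prop

lemma continuous_coefDev (R : Matrix (Fin dx) (Fin dz) ℝ) (γ₀ : (Fin dx → ℝ) × (Fin dz → ℝ))
    (a a₀ : Bool) : Continuous fun γ => coefDev R γ₀ γ a a₀ := by
  unfold coefDev
  cases a <;> simp only [Bool.false_eq_true, if_false, if_true] <;> fun_prop

lemma regMean_sub_regMean (R : Matrix (Fin dx) (Fin dz) ℝ) (T t : ℕ) (τ τ₀ : ℝ)
    (γ γ₀ : (Fin dx → ℝ) × (Fin dz → ℝ)) (x : Fin dx → ℝ) :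
    regMean R T τ γ t x - regMean R T τ₀ γ₀ t x
      = x ⬝ᵥ coefDev R γ₀ γ (strictFloor (τ * T) ≤ t) (strictFloor (τ₀ * T) ≤ t) := by
  have htranspose (δ : Fin dz → ℝ) : (Rᵀ *ᵥ x) ⬝ᵥ δ = x ⬝ᵥ R *ᵥ δ := by
    rw [Matrix.mulVec_transpose, Matrix.dotProduct_mulVec]
  simp only [regMean, coefDev, htranspose, decide_eq_true_eq, dotProduct_add, dotProduct_sub,
    apply_ite (x ⬝ᵥ ·), dotProduct_zero]
  ring

lemma normalLik_eq_exp_logLik (R : Matrix (Fin dx) (Fin dz) ℝ) (T : ℕ)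
    (γ₀ : (Fin dx → ℝ) × (Fin dz → ℝ)) (τ₀ τ : ℝ) (x : ℕ → Fin dx → ℝ) (ε : ℕ → ℝ)
    {θ : Param dx dz} (hθ : 0 < θ.2) :
    normalLik R T (fun t => regMean R T τ₀ γ₀ t (x t) + ε t) x θ τ
      = Real.exp (logLik R T (strictFloor (τ₀ * T)) γ₀ x ε θ (strictFloor (τ * T))) := by
  have hpos : 0 < 2 * Real.pi * θ.2 := by positivity
  have hscale : 1 / √(2 * Real.pi * θ.2) = Real.exp (-(1 / 2 * Real.log (2 * Real.pi * θ.2))) := by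
    rw [Real.exp_neg, one_div, Real.sqrt_eq_rpow, Real.rpow_def_of_pos hpos, mul_comm]
  have hres (t : ℕ) : regMean R T τ₀ γ₀ t (x t) + ε t - regMean R T τ θ.1 t (x t)
      = ε t - x t ⬝ᵥ coefDev R γ₀ θ.1 (strictFloor (τ * T) ≤ t) (strictFloor (τ₀ * T) ≤ t) := by
    rw [← regMean_sub_regMean]
    ring
  unfold normalLik logLik rss
  rw [hscale, Finset.prod_mul_distrib, Finset.prod_const, Finset.card_range, ← Real.exp_nat_mul,
    ← Real.exp_sum, ← Real.exp_add, Finset.sum_div]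
  simp only [hres, neg_div, Finset.sum_neg_distrib]
  congr 1
  ring

/-- The segment of dates between two breaks `n` and `n₀` lies after one of them only, namely after
the true break `n₀` exactly when `n₀ ≤ n`. -/
lemma sum_range_eq_sum_windows (F : Bool → Bool → ℕ → ℝ) {T n n₀ : ℕ} (hn : n ≤ T)
    (hn₀ : n₀ ≤ T) :
    ∑ t ∈ Finset.range T, F (n ≤ t) (n₀ ≤ t) t = ∑ t ∈ Finset.Ico 0 (min n n₀), F false false t
      + ∑ t ∈ Finset.Ico (min n n₀) (max n n₀), F (!decide (n₀ ≤ n)) (n₀ ≤ n) t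
      + ∑ t ∈ Finset.Ico (max n n₀) T, F true true t := by
  rw [Finset.range_eq_Ico, ← Finset.sum_Ico_consecutive _ (Nat.zero_le _) (max_le hn hn₀),
    ← Finset.sum_Ico_consecutive _ (Nat.zero_le _) (min_le_max (a := n) (b := n₀))]
  refine congrArg₂ (· + ·) (congrArg₂ (· + ·) ?_ ?_) ?_ <;>
    refine Finset.sum_congr rfl fun t ht => ?_ <;>
    simp only [Finset.mem_Ico, lt_min_iff, max_le_iff, min_le_iff, lt_max_iff] at ht
  · simp only [ht.2.1.not_ge, ht.2.2.not_ge, decide_false]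
  · rcases le_total n₀ n with h | h
    · simp [h, show n₀ ≤ t by omega, show ¬ n ≤ t by omega]
    · simp [show n ≤ t by omega, show ¬ n₀ ≤ t by omega, show ¬ n₀ ≤ n by omega]
  · simp only [ht.1.1, ht.1.2, decide_true]

lemma abs_sum_sq_residual_sub_le {S : Matrix (Fin dx) (Fin dx) ℝ} {v s B : ℝ}
    {x : ℕ → Fin dx → ℝ} {ε : ℕ → ℝ} {J : Finset ℕ} (hs : 0 ≤ s)
    (hJ : ∀ q, |∑ t ∈ J, momentDev S v q (x t, ε t)| ≤ s) {w : Fin dx → ℝ}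
    (hw : ∑ q, |resWeight w q| ≤ B) :
    |∑ t ∈ J, (ε t - x t ⬝ᵥ w) ^ 2 - J.card * (quadForm S w + v)| ≤ B * s := by
  have hexpand : ∑ t ∈ J, (ε t - x t ⬝ᵥ w) ^ 2 - J.card * (quadForm S w + v)
      = ∑ q, resWeight w q * ∑ t ∈ J, momentDev S v q (x t, ε t) := by
    simp only [sq_residual_eq S v, Finset.sum_add_distrib, Finset.mul_sum]
    rw [Finset.sum_comm, Finset.sum_const, Finset.sum_const]
    simp only [nsmul_eq_mul]
    ring
  rw [hexpand]
  refine (Finset.abs_sum_le_sum_abs _ _).trans ((Finset.sum_le_sum fun q _ => ?_).trans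
    ((Finset.sum_mul Finset.univ _ s).symm.trans_le (mul_le_mul_of_nonneg_right hw hs)))
  rw [abs_mul]
  exact mul_le_mul_of_nonneg_left (hJ q) (abs_nonneg _)

end Expansion

namespace SampleRegular

variable {dx dz : ℕ} {S : Matrix (Fin dx) (Fin dx) ℝ} {v κ c : ℝ} {M T n₀ : ℕ}
  {x : ℕ → Fin dx → ℝ} {ε : ℕ → ℝ} {R : Matrix (Fin dx) (Fin dz) ℝ}
  {γ₀ γ : (Fin dx → ℝ) × (Fin dz → ℝ)} {B : ℝ} {n : ℕ}

lemma abs_sum_Ico_le (h : SampleRegular S v κ c M T n₀ x ε) (q : MomentIndex dx) {a b : ℕ}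
    (hab : a ≤ b) (hb : b ≤ T) :
    |∑ t ∈ Finset.Ico a b, momentDev S v q (x t, ε t)| ≤ 2 * c * T := by
  rw [Finset.sum_Ico_eq_sub _ hab]
  linarith [abs_sub (∑ t ∈ Finset.range b, momentDev S v q (x t, ε t))
    (∑ t ∈ Finset.range a, momentDev S v q (x t, ε t)), h.initial q b hb,
    h.initial q a (hab.trans hb)]

lemma abs_sum_window_le (h : SampleRegular S v κ c M T n₀ x ε) (q : MomentIndex dx) (hn : n ≤ T)
    (hnκ : ((max n n₀ - min n n₀ : ℕ) : ℝ) ≤ κ * T) :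
    |∑ t ∈ Finset.Ico (min n n₀) (max n n₀), momentDev S v q (x t, ε t)|
      ≤ c * ((max n n₀ - min n n₀ : ℕ) + M) := by
  rcases le_total n₀ n with hle | hle
  · rw [min_eq_right hle, max_eq_left hle]
    exact h.after q n hle hn
  · rw [min_eq_left hle, max_eq_right hle] at hnκ ⊢
    exact h.before q n hle hnκ

lemma abs_logLik_sub_expLogLik_le (h : SampleRegular S v κ c M T n₀ x ε) (hc : 0 ≤ c)
    (hn₀ : n₀ ≤ T) (hn : n ≤ T) {θ : Param dx dz} {s : ℝ} (hs : 0 < s) (hsθ : s ≤ θ.2)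
    (hB : ∀ a a₀, ∑ q, |resWeight (coefDev R γ₀ θ.1 a a₀) q| ≤ B) :
    |logLik R T n₀ γ₀ x ε θ n - expLogLik S v R T n₀ γ₀ θ n| ≤ 3 * B * c * T / s := by
  have hwindow (a b : ℕ) (hab : a ≤ b) (hb : b ≤ T) (p p₀ : Bool) :
      |∑ t ∈ Finset.Ico a b, ((ε t - x t ⬝ᵥ coefDev R γ₀ θ.1 p p₀) ^ 2
        - (quadForm S (coefDev R γ₀ θ.1 p p₀) + v))| ≤ B * (2 * c * T) := by
    rw [Finset.sum_sub_distrib, Finset.sum_const, nsmul_eq_mul]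
    exact abs_sum_sq_residual_sub_le (by positivity) (fun q => h.abs_sum_Ico_le q hab hb) (hB p p₀)
  have hrss := sum_range_eq_sum_windows (fun a a₀ t =>
    (ε t - x t ⬝ᵥ coefDev R γ₀ θ.1 a a₀) ^ 2 - (quadForm S (coefDev R γ₀ θ.1 a a₀) + v)) hn hn₀
  rw [Finset.sum_sub_distrib] at hrss
  have hle : |rss R T n₀ γ₀ x ε θ.1 n - ∑ t ∈ Finset.range T,
      (quadForm S (coefDev R γ₀ θ.1 (n ≤ t) (n₀ ≤ t)) + v)| ≤ 6 * B * c * T := by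
    rw [rss, hrss]
    refine (abs_add_three _ _ _).trans ?_
    linarith [hwindow 0 (min n n₀) (Nat.zero_le _) (by omega) false false,
      hwindow (min n n₀) (max n n₀) min_le_max (max_le hn hn₀) (!decide (n₀ ≤ n)) (n₀ ≤ n),
      hwindow (max n n₀) T (max_le hn hn₀) le_rfl true true]
  rw [logLik, expLogLik, sub_sub_sub_cancel_left, ← sub_div, abs_div, abs_sub_comm,
    abs_of_pos (show 0 < 2 * θ.2 by linarith)]
  calc _ ≤ 6 * B * c * T / (2 * θ.2) := by gcongr; linarith
    _ ≤ 6 * B * c * T / (2 * s) := by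
        have := (abs_nonneg _).trans hle
        gcongr
    _ = 3 * B * c * T / s := by field_simp; ring

lemma abs_rss_sub_rss_sub_le (h : SampleRegular S v κ c M T n₀ x ε) (hc : 0 ≤ c) (hn₀ : n₀ ≤ T)
    (hn : n ≤ T) (hnκ : ((max n n₀ - min n n₀ : ℕ) : ℝ) ≤ κ * T)
    (hB : ∀ a a₀, ∑ q, |resWeight (coefDev R γ₀ γ a a₀) q| ≤ B) :
    |rss R T n₀ γ₀ x ε γ n - rss R T n₀ γ₀ x ε γ n₀ - (max n n₀ - min n n₀ : ℕ) *
      (quadForm S (coefDev R γ₀ γ (!decide (n₀ ≤ n)) (n₀ ≤ n))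
        - quadForm S (coefDev R γ₀ γ (n₀ ≤ n) (n₀ ≤ n)))|
      ≤ 2 * B * c * ((max n n₀ - min n n₀ : ℕ) + M) := by
  set s := decide (n₀ ≤ n) with hs
  have hsplit : rss R T n₀ γ₀ x ε γ n - rss R T n₀ γ₀ x ε γ n₀
      = ∑ t ∈ Finset.Ico (min n n₀) (max n n₀), (ε t - x t ⬝ᵥ coefDev R γ₀ γ (!s) s) ^ 2
        - ∑ t ∈ Finset.Ico (min n n₀) (max n n₀), (ε t - x t ⬝ᵥ coefDev R γ₀ γ s s) ^ 2 := by
    rw [rss, rss, ← Finset.sum_sub_distrib, sum_range_eq_sum_windows (fun a a₀ t =>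
      (ε t - x t ⬝ᵥ coefDev R γ₀ γ a a₀) ^ 2 - (ε t - x t ⬝ᵥ coefDev R γ₀ γ a₀ a₀) ^ 2) hn hn₀]
    simp only [sub_self, Finset.sum_const_zero, zero_add, add_zero, Finset.sum_sub_distrib, hs]
  have hwindow (p : Bool) := abs_sum_sq_residual_sub_le (by positivity)
    (fun q => h.abs_sum_window_le q hn hnκ) (hB p s)
  simp only [Nat.card_Ico] at hwindow
  rw [hsplit]
  refine le_of_eq_of_le (congrArg abs ?_) ((abs_sub _ _).trans
    ((add_le_add (hwindow (!s)) (hwindow s)).trans_eq ?_)) <;> ring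

end SampleRegular

section ExpectedExcess

variable {dx dz : ℕ} {S : Matrix (Fin dx) (Fin dx) ℝ} {R : Matrix (Fin dx) (Fin dz) ℝ}
  {γ₀ γ : (Fin dx → ℝ) × (Fin dz → ℝ)} {v v₀ p p' : ℝ} {θ : Param dx dz}

/-- The expected log likelihood ratio, per observation, between the normal densities with true
variance `v₀` and with variance `v`. -/
def varLoss (v₀ v : ℝ) : ℝ :=
  (Real.log (v / v₀) + v₀ / v - 1) / 2

/-- The limiting divergence per observation of the model with the true break location, when the
observations before and after the break have weights `p` and `p'`. -/
def limLoss (S : Matrix (Fin dx) (Fin dx) ℝ) (R : Matrix (Fin dx) (Fin dz) ℝ)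
    (γ₀ : (Fin dx → ℝ) × (Fin dz → ℝ)) (v₀ p p' : ℝ) (θ : Param dx dz) : ℝ :=
  varLoss v₀ θ.2 + (p * quadForm S (coefDev R γ₀ θ.1 false false)
    + p' * quadForm S (coefDev R γ₀ θ.1 true true)) / (2 * θ.2)

@[simp]
lemma quadForm_zero : quadForm S 0 = 0 := by simp [quadForm]

@[simp]
lemma quadForm_neg (w : Fin dx → ℝ) : quadForm S (-w) = quadForm S w := by
  simp [quadForm, Matrix.mulVec_neg]

lemma quadForm_pos (hS : S.PosDef) {w : Fin dx → ℝ} (hw : w ≠ 0) : 0 < quadForm S w := by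
  simpa [quadForm] using hS.dotProduct_mulVec_pos hw

lemma quadForm_nonneg (hS : S.PosDef) (w : Fin dx → ℝ) : 0 ≤ quadForm S w := by
  simpa [quadForm] using hS.posSemidef.dotProduct_mulVec_nonneg w

lemma quadForm_sub_le (hS : S.PosDef) (w w' : Fin dx → ℝ) :
    quadForm S (w - w') ≤ 2 * (quadForm S w + quadForm S w') := by
  have h := quadForm_nonneg hS (w + w')
  simp only [quadForm, Matrix.mulVec_add, Matrix.mulVec_sub, dotProduct_add, dotProduct_sub,
    add_dotProduct, sub_dotProduct] at h ⊢
  linarith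

lemma mulVec_injective_of_rank_eq (hR : R.rank = dz) : Function.Injective (R *ᵥ ·) := by
  rw [Matrix.mulVec_injective_iff, linearIndependent_iff_card_eq_finrank_span, Set.finrank,
    ← Matrix.rank_eq_finrank_span_cols, hR, Fintype.card_fin]

@[simp]
lemma coefDev_self (a : Bool) : coefDev R γ₀ γ₀ a a = 0 := by simp [coefDev]

lemma coefDev_false_false : coefDev R γ₀ γ false false = γ.1 - γ₀.1 := by
  simp [coefDev]

lemma coefDev_true_true :
    coefDev R γ₀ γ true true = γ.1 - γ₀.1 + R *ᵥ (γ.2 - γ₀.2) := by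
  simp [coefDev, Matrix.mulVec_sub, add_sub_assoc]

lemma eq_of_coefDev_eq_zero (hR : R.rank = dz) (hff : coefDev R γ₀ γ false false = 0)
    (htt : coefDev R γ₀ γ true true = 0) : γ = γ₀ := by
  rw [coefDev_false_false] at hff
  rw [coefDev_true_true, hff, zero_add] at htt
  have hδ : γ.2 - γ₀.2 = 0 := mulVec_injective_of_rank_eq hR (by simpa using htt)
  exact Prod.ext (sub_eq_zero.mp hff) (sub_eq_zero.mp hδ)

/-- Misplacing the break costs at least half the squared jump, either at the dates on the wrong
side of it or at those beyond. -/
lemma quadForm_jump_le (hS : S.PosDef) (s : Bool) :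
    quadForm S (R *ᵥ γ₀.2) ≤ 2 * (quadForm S (coefDev R γ₀ γ (!s) (!s))
      + quadForm S (coefDev R γ₀ γ (!s) s)) := by
  refine le_of_eq_of_le ?_ (quadForm_sub_le hS _ _)
  cases s <;> simp only [coefDev, Bool.not_true, Bool.not_false, if_true, if_false,
    Bool.false_eq_true, sub_zero, sub_sub_cancel_left, quadForm_neg, sub_sub_cancel]

lemma varLoss_eq (hv₀ : 0 < v₀) (hv : 0 < v) :
    varLoss v₀ v = (v₀ / v - 1 - Real.log (v₀ / v)) / 2 := by
  rw [varLoss, Real.log_div hv.ne' hv₀.ne', Real.log_div hv₀.ne' hv.ne']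
  ring

lemma varLoss_nonneg (hv₀ : 0 < v₀) (hv : 0 < v) : 0 ≤ varLoss v₀ v := by
  rw [varLoss_eq hv₀ hv]
  linarith [Real.log_le_sub_one_of_pos (div_pos hv₀ hv)]

lemma varLoss_pos (hv₀ : 0 < v₀) (hv : 0 < v) (h : v ≠ v₀) : 0 < varLoss v₀ v := by
  have hratio : v₀ / v ≠ 1 := fun h' => h ((div_eq_one_iff_eq hv.ne').mp h').symm
  rw [varLoss_eq hv₀ hv]
  linarith [Real.log_lt_sub_one_of_pos (div_pos hv₀ hv) hratio]

lemma varLoss_self (hv₀ : 0 < v₀) : varLoss v₀ v₀ = 0 := by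
  simp [varLoss, hv₀.ne']

lemma limLoss_nonneg (hS : S.PosDef) (hv₀ : 0 < v₀) (hp : 0 ≤ p) (hp' : 0 ≤ p') (hθ : 0 < θ.2) :
    0 ≤ limLoss S R γ₀ v₀ p p' θ := by
  have hvar := varLoss_nonneg hv₀ hθ
  have hff := quadForm_nonneg hS (coefDev R γ₀ θ.1 false false)
  have htt := quadForm_nonneg hS (coefDev R γ₀ θ.1 true true)
  unfold limLoss
  positivity

lemma limLoss_pos (hS : S.PosDef) (hR : R.rank = dz) (hv₀ : 0 < v₀) (hp : 0 < p) (hp' : 0 < p')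
    (hθ : 0 < θ.2) (hne : θ ≠ (γ₀, v₀)) : 0 < limLoss S R γ₀ v₀ p p' θ := by
  have hff := quadForm_nonneg hS (coefDev R γ₀ θ.1 false false)
  have htt := quadForm_nonneg hS (coefDev R γ₀ θ.1 true true)
  unfold limLoss
  by_cases hv : θ.2 = v₀
  · have hvar := varLoss_nonneg hv₀ hθ
    have hγ : θ.1 ≠ γ₀ := fun h => hne (Prod.ext h hv)
    by_cases h0 : coefDev R γ₀ θ.1 false false = 0
    · have := quadForm_pos hS fun h => hγ (eq_of_coefDev_eq_zero hR h0 h)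
      positivity
    · have := quadForm_pos hS h0
      positivity
  · have := varLoss_pos hv₀ hθ hv
    positivity

lemma limLoss_true (hv₀ : 0 < v₀) : limLoss S R γ₀ v₀ p p' (γ₀, v₀) = 0 := by
  simp [limLoss, varLoss_self hv₀]

lemma continuous_quadForm_coefDev (a a₀ : Bool) :
    Continuous fun θ : Param dx dz => quadForm S (coefDev R γ₀ θ.1 a a₀) :=
  (continuous_quadForm S).comp ((continuous_coefDev R γ₀ a a₀).comp continuous_fst)

lemma continuousAt_limLoss (hv₀ : 0 < v₀) (hθ : 0 < θ.2) :
    ContinuousAt (limLoss S R γ₀ v₀ p p') θ := by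
  have hff := continuous_quadForm_coefDev (S := S) (R := R) (γ₀ := γ₀) false false
  have htt := continuous_quadForm_coefDev (S := S) (R := R) (γ₀ := γ₀) true true
  have hlog : θ.2 / v₀ ≠ 0 := (div_pos hθ hv₀).ne'
  have hθ' := hθ.ne'
  unfold limLoss varLoss
  fun_prop (disch := first | assumption | positivity)

lemma expLogLik_true_sub_expLogLik {T n n₀ : ℕ} (hv₀ : 0 < v₀) (hθ : 0 < θ.2) :
    expLogLik S v₀ R T n₀ γ₀ (γ₀, v₀) n₀ - expLogLik S v₀ R T n₀ γ₀ θ n = T * varLoss v₀ θ.2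
      + (∑ t ∈ Finset.range T, quadForm S (coefDev R γ₀ θ.1 (n ≤ t) (n₀ ≤ t))) / (2 * θ.2) := by
  simp only [expLogLik, varLoss, coefDev_self, quadForm_zero, zero_add, Finset.sum_add_distrib,
    Finset.sum_const, Finset.card_range, nsmul_eq_mul]
  rw [Real.log_div hθ.ne' hv₀.ne', Real.log_mul (by positivity) hθ.ne',
    Real.log_mul (by positivity) hv₀.ne']
  field_simp
  ring

lemma expLogLik_true_sub_expLogLik_self {T n₀ : ℕ} (hT : 0 < T) (hn₀ : n₀ ≤ T) (hv₀ : 0 < v₀)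
    (hθ : 0 < θ.2) :
    expLogLik S v₀ R T n₀ γ₀ (γ₀, v₀) n₀ - expLogLik S v₀ R T n₀ γ₀ θ n₀
      = T * limLoss S R γ₀ v₀ (n₀ / T) (1 - n₀ / T) θ := by
  have hT' : (T : ℝ) ≠ 0 := by positivity
  rw [expLogLik_true_sub_expLogLik hv₀ hθ, limLoss, sum_range_eq_sum_windows (fun a a₀ _ =>
    quadForm S (coefDev R γ₀ θ.1 a a₀)) hn₀ hn₀]
  simp only [min_self, max_self, Finset.sum_const, Nat.card_Ico, nsmul_eq_mul, Nat.cast_sub hn₀,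
    Nat.sub_zero, Nat.sub_self, Nat.cast_zero, zero_mul, add_zero]
  field_simp

end ExpectedExcess

section PseudoTrue

variable {Ω : Type*} [MeasurableSpace Ω] {μ : Measure Ω} [IsProbabilityMeasure μ] {dx dz : ℕ}
  {x : ℕ → Ω → Fin dx → ℝ} {ε : ℕ → Ω → ℝ} {S : Matrix (Fin dx) (Fin dx) ℝ} {v₀ : ℝ}
  {R : Matrix (Fin dx) (Fin dz) ℝ} {γ₀ : (Fin dx → ℝ) × (Fin dz → ℝ)} {θ : Param dx dz} {τ₀ : ℝ}

lemma ErgodicMoments.integrable_sq_residual (h : ErgodicMoments μ x ε S v₀) (w : Fin dx → ℝ)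
    (t : ℕ) : Integrable (fun ω => (ε t ω - x t ω ⬝ᵥ w) ^ 2) μ := by
  simp only [sq_residual_eq S v₀]
  exact (integrable_const _).add
    (integrable_finsetSum _ fun q _ => ((h.centred q).integrable t).const_mul _)

lemma ErgodicMoments.integral_sq_residual (h : ErgodicMoments μ x ε S v₀) (w : Fin dx → ℝ)
    (t : ℕ) : ∫ ω, (ε t ω - x t ω ⬝ᵥ w) ^ 2 ∂μ = quadForm S w + v₀ := by
  have hint (q : MomentIndex dx) := ((h.centred q).integrable t).const_mul (resWeight w q)
  simp only [sq_residual_eq S v₀]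
  rw [integral_add (integrable_const _) (integrable_finsetSum _ fun q _ => hint q),
    integral_finsetSum _ fun q _ => hint q]
  simp only [integral_const_mul, (h.centred _).integral_eq_zero, mul_zero, Finset.sum_const_zero,
    integral_const, probReal_univ, one_smul, add_zero]

lemma ErgodicMoments.meanLogLik_eq (h : ErgodicMoments μ x ε S v₀) (T : ℕ) (τ : ℝ)
    (hθ : 0 < θ.2) : meanLogLik μ R x ε γ₀ τ₀ T θ τ
      = expLogLik S v₀ R T (strictFloor (τ₀ * T)) γ₀ θ (strictFloor (τ * T)) := by
  have hlog (ω : Ω) : Real.log (normalLik R T (response R x ε γ₀ τ₀ T ω) (fun t => x t ω) θ τ)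
      = logLik R T (strictFloor (τ₀ * T)) γ₀ (fun t => x t ω) (fun t => ε t ω) θ
        (strictFloor (τ * T)) :=
    (congrArg Real.log (normalLik_eq_exp_logLik R T γ₀ τ₀ τ _ _ hθ)).trans (Real.log_exp _)
  simp only [meanLogLik, hlog, logLik, expLogLik, rss]
  rw [integral_sub (integrable_const _) ((integrable_finsetSum _ fun t _ =>
    h.integrable_sq_residual _ t).div_const _), integral_div,
    integral_finsetSum _ fun t _ => h.integrable_sq_residual _ t]
  simp only [h.integral_sq_residual, integral_const, probReal_univ, one_smul]

lemma tendsto_strictFloor_div (hτ : 0 < τ₀) :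
    Tendsto (fun T : ℕ => (strictFloor (τ₀ * T) : ℝ) / T) atTop (𝓝 τ₀) := by
  have hlower : Tendsto (fun T : ℕ => τ₀ - 1 / (T : ℝ)) atTop (𝓝 τ₀) := by
    simpa using tendsto_const_nhds.sub (tendsto_one_div_atTop_nhds_zero_nat (𝕜 := ℝ))
  refine tendsto_of_tendsto_of_tendsto_of_le_of_le' hlower tendsto_const_nhds ?_ ?_ <;>
    filter_upwards [eventually_ge_atTop 1] with T hT <;>
    have hT0 : (0 : ℝ) < T := by exact_mod_cast hT
  · rw [le_div_iff₀ hT0, sub_mul, one_div_mul_cancel hT0.ne']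
    linarith [(strictFloor_spec (mul_pos hτ hT0)).2]
  · rw [div_le_iff₀ hT0]
    exact (strictFloor_spec (mul_pos hτ hT0)).1.le

lemma strictFloor_mul_le {τ : ℝ} (hτ : τ ≤ 1) (T : ℕ) : strictFloor (τ * T) ≤ T :=
  (Nat.sub_le _ _).trans (Nat.ceil_le.mpr (mul_le_of_le_one_left (Nat.cast_nonneg T) hτ))

lemma ErgodicMoments.tendsto_meanLogLik_sub (h : ErgodicMoments μ x ε S v₀) (hτ : 0 < τ₀)
    (hτ1 : τ₀ < 1) (hθ : 0 < θ.2) :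
    Tendsto (fun T : ℕ => (1 / (T : ℝ)) * (meanLogLik μ R x ε γ₀ τ₀ T (γ₀, v₀) τ₀
      - meanLogLik μ R x ε γ₀ τ₀ T θ τ₀)) atTop (𝓝 (limLoss S R γ₀ v₀ τ₀ (1 - τ₀) θ)) := by
  have hfrac := tendsto_strictFloor_div hτ
  have hlim : Tendsto (fun T : ℕ => limLoss S R γ₀ v₀ (strictFloor (τ₀ * T) / T)
      (1 - strictFloor (τ₀ * T) / T) θ) atTop (𝓝 (limLoss S R γ₀ v₀ τ₀ (1 - τ₀) θ)) :=
    tendsto_const_nhds.add (((hfrac.mul_const _).add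
      ((tendsto_const_nhds.sub hfrac).mul_const _)).div_const _)
  refine hlim.congr' ?_
  filter_upwards [eventually_gt_atTop 0] with T hT
  rw [h.meanLogLik_eq T τ₀ hθ, h.meanLogLik_eq T τ₀ h.variance_pos,
    expLogLik_true_sub_expLogLik_self hT (strictFloor_mul_le hτ1.le T) h.variance_pos hθ]
  field_simp

lemma ErgodicMoments.pseudoTrue_eq (h : ErgodicMoments μ x ε S v₀) (hR : R.rank = dz)
    (hτ : 0 < τ₀) (hτ1 : τ₀ < 1) : pseudoTrue μ R x ε γ₀ τ₀ τ₀ = (γ₀, v₀) := by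
  have hexists : IsPseudoTrue μ R x ε γ₀ τ₀ τ₀ (γ₀, v₀) :=
    ⟨h.variance_pos, fun θ' hθ' => ⟨_, limLoss_nonneg h.posDef h.variance_pos hτ.le
      (by linarith) hθ', h.tendsto_meanLogLik_sub hτ hτ1 hθ'⟩⟩
  obtain ⟨hpos, hmin⟩ : IsPseudoTrue μ R x ε γ₀ τ₀ τ₀ (pseudoTrue μ R x ε γ₀ τ₀ τ₀) :=
    Classical.epsilon_spec ⟨_, hexists⟩
  by_contra hne
  obtain ⟨d, hd, hlim⟩ := hmin (γ₀, v₀) h.variance_pos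
  have hneg := (h.tendsto_meanLogLik_sub (R := R) (γ₀ := γ₀) hτ hτ1 hpos).neg
  simp only [← mul_neg, neg_sub] at hneg
  have hloss := limLoss_pos h.posDef hR h.variance_pos hτ (sub_pos.mpr hτ1) hpos hne
  linarith [tendsto_nhds_unique hlim hneg]

end PseudoTrue

section UniformBounds

variable {dx dz : ℕ} {S : Matrix (Fin dx) (Fin dx) ℝ} {R : Matrix (Fin dx) (Fin dz) ℝ}
  {γ₀ : (Fin dx → ℝ) × (Fin dz → ℝ)} {v₀ κ : ℝ} {Θ : Set (Param dx dz)} {θ : Param dx dz}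
  {T n n₀ : ℕ}

/-- Uniform bounds over the parameter space: `s₁` and `s₂` for the variances, and `C` for the
coefficients of the expansion of the squared residuals. -/
structure ParamBounds (S : Matrix (Fin dx) (Fin dx) ℝ) (R : Matrix (Fin dx) (Fin dz) ℝ)
    (γ₀ : (Fin dx → ℝ) × (Fin dz → ℝ)) (Θ : Set (Param dx dz)) (s₁ s₂ C : ℝ) : Prop where
  lower_pos : 0 < s₁
  upper_pos : 0 < s₂
  coef_pos : 0 < C
  le_variance : ∀ θ ∈ Θ, s₁ ≤ θ.2
  variance_le : ∀ θ ∈ Θ, θ.2 ≤ s₂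
  sum_resWeight_le : ∀ θ ∈ Θ, ∀ a a₀, ∑ q, |resWeight (coefDev R γ₀ θ.1 a a₀) q| ≤ C
  quadForm_le : ∀ θ ∈ Θ, ∀ a a₀, quadForm S (coefDev R γ₀ θ.1 a a₀) ≤ C

lemma exists_paramBounds (hΘ : IsCompact Θ) (hpos : ∀ θ ∈ Θ, 0 < θ.2) (hne : Θ.Nonempty) :
    ∃ s₁ s₂ C : ℝ, ParamBounds S R γ₀ Θ s₁ s₂ C := by
  obtain ⟨θ₁, hθ₁, hmin⟩ := hΘ.exists_isMinOn hne continuous_snd.continuousOn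
  obtain ⟨θ₂, hθ₂, hmax⟩ := hΘ.exists_isMaxOn hne continuous_snd.continuousOn
  have hcont : Continuous fun θ : Param dx dz => fun p : Bool × Bool =>
      (∑ q, |resWeight (coefDev R γ₀ θ.1 p.1 p.2) q|, quadForm S (coefDev R γ₀ θ.1 p.1 p.2)) := by
    refine continuous_pi fun p => (continuous_finsetSum _ fun q _ => ?_).prodMk
      (continuous_quadForm_coefDev _ _)
    exact ((continuous_resWeight q).comp
      ((continuous_coefDev R γ₀ _ _).comp continuous_fst)).abs
  obtain ⟨C, hC⟩ := hΘ.exists_bound_of_continuousOn hcont.continuousOn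
  have hC' (θ : Param dx dz) (hθ : θ ∈ Θ) (a a₀ : Bool) :=
    norm_prod_le_iff.mp ((norm_le_pi_norm _ (a, a₀)).trans (hC θ hθ))
  refine ⟨θ₁.2, θ₂.2, max C 1, hpos _ hθ₁, hpos _ hθ₂, by positivity, fun θ hθ => hmin hθ,
    fun θ hθ => hmax hθ, fun θ hθ a a₀ => ?_, fun θ hθ a a₀ => ?_⟩
  · exact (le_abs_self _).trans ((hC' θ hθ a a₀).1.trans (le_max_left _ _))
  · exact (le_abs_self _).trans ((hC' θ hθ a a₀).2.trans (le_max_left _ _))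

lemma exists_limLoss_lower_bound (hS : S.PosDef) (hR : R.rank = dz) (hv₀ : 0 < v₀)
    (hΘ : IsCompact Θ) (hpos : ∀ θ ∈ Θ, 0 < θ.2) {B : Set (Param dx dz)} (hB : IsOpen B)
    (hθ₀ : (γ₀, v₀) ∈ B) (hκ : 0 < κ) :
    ∃ z : ℝ, 0 < z ∧ ∀ θ ∈ Θ, θ ∉ B → z ≤ limLoss S R γ₀ v₀ κ κ θ := by
  rcases (Θ \ B).eq_empty_or_nonempty with hempty | hne
  · exact ⟨1, one_pos, fun θ hθ hθB => (hempty.subset ⟨hθ, hθB⟩).elim⟩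
  · obtain ⟨θ₁, hθ₁, hmin⟩ := (hΘ.diff hB).exists_isMinOn hne
      (f := limLoss S R γ₀ v₀ κ κ) fun θ hθ =>
        (continuousAt_limLoss hv₀ (hpos θ hθ.1)).continuousWithinAt
    refine ⟨_, limLoss_pos hS hR hv₀ hκ hκ (hpos _ hθ₁.1) ?_, fun θ hθ hθB => hmin ⟨hθ, hθB⟩⟩
    rintro rfl
    exact hθ₁.2 hθ₀

lemma eventually_quadForm_gap (hS : S.PosDef) (hδ : R *ᵥ γ₀.2 ≠ 0) :
    ∀ᶠ θ : Param dx dz in 𝓝 (γ₀, v₀), ∀ s, quadForm S (R *ᵥ γ₀.2) / 2 ≤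
      quadForm S (coefDev R γ₀ θ.1 (!s) s) - quadForm S (coefDev R γ₀ θ.1 s s) := by
  have hq := quadForm_pos hS hδ
  refine eventually_all.mpr fun s => ((continuous_quadForm_coefDev (!s) s).sub
    (continuous_quadForm_coefDev s s)).continuousAt.eventually_const_le ?_
  cases s <;> simp only [Pi.sub_apply, coefDev, Bool.not_true, Bool.not_false, if_true, if_false,
    Bool.false_eq_true, sub_self, zero_add, sub_zero, zero_sub, quadForm_neg, quadForm_zero] <;>
    linarith

lemma limLoss_mono (hS : S.PosDef) (hθ : 0 < θ.2) {p p' q q' : ℝ} (hpq : p ≤ q) (hpq' : p' ≤ q') :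
    limLoss S R γ₀ v₀ p p' θ ≤ limLoss S R γ₀ v₀ q q' θ := by
  have hff := quadForm_nonneg hS (coefDev R γ₀ θ.1 false false)
  have htt := quadForm_nonneg hS (coefDev R γ₀ θ.1 true true)
  unfold limLoss
  gcongr

lemma sum_quadForm_eq_windows (hn : n ≤ T) (hn₀ : n₀ ≤ T) :
    ∑ t ∈ Finset.range T, quadForm S (coefDev R γ₀ θ.1 (n ≤ t) (n₀ ≤ t))
      = (min n n₀ : ℕ) * quadForm S (coefDev R γ₀ θ.1 false false)
        + (max n n₀ - min n n₀ : ℕ) * quadForm S (coefDev R γ₀ θ.1 (!decide (n₀ ≤ n)) (n₀ ≤ n))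
        + (T - max n n₀ : ℕ) * quadForm S (coefDev R γ₀ θ.1 true true) := by
  rw [sum_range_eq_sum_windows (fun a a₀ _ => quadForm S (coefDev R γ₀ θ.1 a a₀)) hn hn₀]
  simp only [Finset.sum_const, Nat.card_Ico, nsmul_eq_mul, Nat.sub_zero]

lemma mul_limLoss_le_expLogLik_sub (hS : S.PosDef) (hv₀ : 0 < v₀) (hθ : 0 < θ.2) (hn : n ≤ T)
    (hn₀ : n₀ ≤ T) (hmin : κ * T ≤ (min n n₀ : ℕ)) (hmax : κ * T ≤ (T - max n n₀ : ℕ)) :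
    T * limLoss S R γ₀ v₀ κ κ θ
      ≤ expLogLik S v₀ R T n₀ γ₀ (γ₀, v₀) n₀ - expLogLik S v₀ R T n₀ γ₀ θ n := by
  have hff := quadForm_nonneg hS (coefDev R γ₀ θ.1 false false)
  have hmid := quadForm_nonneg hS (coefDev R γ₀ θ.1 (!decide (n₀ ≤ n)) (n₀ ≤ n))
  have htt := quadForm_nonneg hS (coefDev R γ₀ θ.1 true true)
  rw [expLogLik_true_sub_expLogLik hv₀ hθ, sum_quadForm_eq_windows hn hn₀, limLoss, mul_add,
    mul_div_assoc']
  gcongr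
  nlinarith [mul_le_mul_of_nonneg_right hmin hff, mul_le_mul_of_nonneg_right hmax htt,
    mul_nonneg (Nat.cast_nonneg (α := ℝ) (max n n₀ - min n n₀)) hmid]

lemma mul_jump_le_expLogLik_sub (hS : S.PosDef) (hv₀ : 0 < v₀) (hθ : 0 < θ.2) (hn : n ≤ T)
    (hn₀ : n₀ ≤ T) {l : ℝ} (hl : 0 ≤ l) (hlen : l ≤ (max n n₀ - min n n₀ : ℕ)) (hl₀ : l ≤ n₀)
    (hlT : l ≤ (T - n₀ : ℕ)) : l * quadForm S (R *ᵥ γ₀.2) / (4 * θ.2)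
      ≤ expLogLik S v₀ R T n₀ γ₀ (γ₀, v₀) n₀ - expLogLik S v₀ R T n₀ γ₀ θ n := by
  have hff := quadForm_nonneg hS (coefDev R γ₀ θ.1 false false)
  have hmid := quadForm_nonneg hS (coefDev R γ₀ θ.1 (!decide (n₀ ≤ n)) (n₀ ≤ n))
  have htt := quadForm_nonneg hS (coefDev R γ₀ θ.1 true true)
  have hjump := mul_le_mul_of_nonneg_left
    (quadForm_jump_le (R := R) (γ₀ := γ₀) (γ := θ.1) hS (decide (n₀ ≤ n))) hl
  have hsum : l * quadForm S (R *ᵥ γ₀.2) / 2 ≤ ∑ t ∈ Finset.range T,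
      quadForm S (coefDev R γ₀ θ.1 (n ≤ t) (n₀ ≤ t)) := by
    rw [sum_quadForm_eq_windows hn hn₀]
    have hwindow := mul_le_mul_of_nonneg_right hlen hmid
    rcases le_or_gt n₀ n with hle | hlt
    · have hbefore := mul_le_mul_of_nonneg_right hl₀ hff
      have hafter := mul_nonneg (Nat.cast_nonneg (α := ℝ) (T - n)) htt
      simp only [min_eq_right hle, max_eq_left hle, hle, decide_true, Bool.not_true]
        at hwindow hjump ⊢
      linarith
    · have hafter := mul_le_mul_of_nonneg_right hlT htt
      have hbefore := mul_nonneg (Nat.cast_nonneg (α := ℝ) n) hff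
      simp only [min_eq_left hlt.le, max_eq_right hlt.le, hlt.not_ge, decide_false, Bool.not_false]
        at hwindow hjump ⊢
      linarith
  have hvar := mul_nonneg (Nat.cast_nonneg (α := ℝ) T) (varLoss_nonneg hv₀ hθ)
  rw [expLogLik_true_sub_expLogLik hv₀ hθ]
  calc l * quadForm S (R *ᵥ γ₀.2) / (4 * θ.2) = l * quadForm S (R *ᵥ γ₀.2) / 2 / (2 * θ.2) := by
        ring
    _ ≤ _ := (div_le_div_of_nonneg_right hsum (by positivity)).trans (le_add_of_nonneg_left hvar)

lemma expLogLik_sub_le (hS : S.PosDef) (hv₀ : 0 < v₀) (hθ : 0 < θ.2) (hT : 0 < T) (hn₀ : n₀ ≤ T) :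
    expLogLik S v₀ R T n₀ γ₀ (γ₀, v₀) n₀ - expLogLik S v₀ R T n₀ γ₀ θ n₀
      ≤ T * limLoss S R γ₀ v₀ 1 1 θ := by
  have hfrac : (n₀ / T : ℝ) ≤ 1 := div_le_one_of_le₀ (by exact_mod_cast hn₀) (by positivity)
  have hfrac' : (1 - n₀ / T : ℝ) ≤ 1 := sub_le_self _ (by positivity)
  rw [expLogLik_true_sub_expLogLik_self hT hn₀ hv₀ hθ]
  gcongr
  exact limLoss_mono hS hθ hfrac hfrac'

end UniformBounds

section LikelihoodRatio

variable {dx dz : ℕ} {S : Matrix (Fin dx) (Fin dx) ℝ} {R : Matrix (Fin dx) (Fin dz) ℝ}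
  {γ₀ : (Fin dx → ℝ) × (Fin dz → ℝ)} {v₀ κ c s₁ s₂ C τ τ₀ : ℝ} {Θ : Set (Param dx dz)}
  {θ : Param dx dz} {M T n n₀ : ℕ} {x : ℕ → Fin dx → ℝ} {ε : ℕ → ℝ}

lemma abs_windowLength_sub_le (hτ : 0 < τ) (hτ₀ : 0 < τ₀) (hT : 0 < T) :
    |((max (strictFloor (τ * T)) (strictFloor (τ₀ * T))
      - min (strictFloor (τ * T)) (strictFloor (τ₀ * T)) : ℕ) : ℝ) - (T * |τ - τ₀|)| ≤ 1 := by
  have hT0 : (0 : ℝ) < T := by exact_mod_cast hT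
  have hn := strictFloor_spec (mul_pos hτ hT0)
  have hn₀ := strictFloor_spec (mul_pos hτ₀ hT0)
  have hdist : T * |τ - τ₀| = |τ * T - τ₀ * T| := by
    rw [← sub_mul, abs_mul, abs_of_pos hT0, mul_comm]
  rw [Nat.cast_sub min_le_max, Nat.cast_max, Nat.cast_min, max_sub_min_eq_abs', hdist]
  exact (abs_abs_sub_abs_le _ _).trans (abs_le.mpr (by constructor <;> linarith))

lemma ParamBounds.mul_le_expLogLik_sub_of_far_break (hP : ParamBounds S R γ₀ Θ s₁ s₂ C)
    (hS : S.PosDef) (hv₀ : 0 < v₀) (hκτ : 3 * κ ≤ τ₀) (hκτ' : 3 * κ ≤ 1 - τ₀)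
    (hκ : 0 < κ) (hT : 2 ≤ κ * T) (hθ : θ ∈ Θ) (hτ : τ ∈ Ioo (0 : ℝ) 1) (hfar : κ ≤ |τ - τ₀|) :
    T * (κ * quadForm S (R *ᵥ γ₀.2) / (8 * s₂))
      ≤ expLogLik S v₀ R T (strictFloor (τ₀ * T)) γ₀ (γ₀, v₀) (strictFloor (τ₀ * T))
        - expLogLik S v₀ R T (strictFloor (τ₀ * T)) γ₀ θ (strictFloor (τ * T)) := by
  have hθ0 : 0 < θ.2 := hP.lower_pos.trans_le (hP.le_variance θ hθ)
  have hT0 : (0 : ℝ) < T := pos_of_mul_pos_right (two_pos.trans_le hT) hκ.le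
  have hτ₀T : 0 < τ₀ * T := mul_pos (by linarith) hT0
  have hn₀T := strictFloor_mul_le (show τ₀ ≤ 1 by linarith) T
  have hlen := (abs_le.mp (abs_windowLength_sub_le hτ.1 (show 0 < τ₀ by linarith)
    (by exact_mod_cast hT0))).1
  have hdist := mul_le_mul_of_nonneg_left hfar hT0.le
  have hleft := mul_le_mul_of_nonneg_right hκτ hT0.le
  have hright := mul_le_mul_of_nonneg_right hκτ' hT0.le
  have hfloor := strictFloor_spec hτ₀T
  refine le_trans ?_ (mul_jump_le_expLogLik_sub (l := κ * T / 2) hS hv₀ hθ0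
    (strictFloor_mul_le hτ.2.le T) hn₀T (by positivity) (by linarith) (by linarith) ?_)
  · have hq := quadForm_nonneg hS (R *ᵥ γ₀.2)
    calc T * (κ * quadForm S (R *ᵥ γ₀.2) / (8 * s₂))
        = κ * T / 2 * quadForm S (R *ᵥ γ₀.2) / (4 * s₂) := by ring
      _ ≤ _ := by
        gcongr
        exact hP.variance_le θ hθ
  · rw [Nat.cast_sub hn₀T]
    linarith

lemma mul_limLoss_le_expLogLik_sub_of_near_break (hS : S.PosDef) (hv₀ : 0 < v₀) (hθ : 0 < θ.2)
    (hκτ : 3 * κ ≤ τ₀) (hκτ' : 3 * κ ≤ 1 - τ₀) (hκ : 0 < κ) (hT : 2 ≤ κ * T)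
    (hτ : τ ∈ Ioo (0 : ℝ) 1) (hnear : |τ - τ₀| < κ) :
    T * limLoss S R γ₀ v₀ κ κ θ
      ≤ expLogLik S v₀ R T (strictFloor (τ₀ * T)) γ₀ (γ₀, v₀) (strictFloor (τ₀ * T))
        - expLogLik S v₀ R T (strictFloor (τ₀ * T)) γ₀ θ (strictFloor (τ * T)) := by
  have hT0 : (0 : ℝ) < T := pos_of_mul_pos_right (two_pos.trans_le hT) hκ.le
  have hτ₀ : 0 < τ₀ := by linarith
  have hnT := strictFloor_mul_le hτ.2.le T
  have hn₀T := strictFloor_mul_le (show τ₀ ≤ 1 by linarith) T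
  have hfloor := strictFloor_spec (mul_pos hτ.1 hT0)
  have hfloor₀ := strictFloor_spec (mul_pos hτ₀ hT0)
  obtain ⟨hlo, hhi⟩ := abs_lt.mp hnear
  have hleft := mul_le_mul_of_nonneg_right (show 2 * κ ≤ τ by linarith) hT0.le
  have hleft₀ := mul_le_mul_of_nonneg_right hκτ hT0.le
  have hright := mul_le_mul_of_nonneg_right (show 2 * κ ≤ 1 - τ by linarith) hT0.le
  have hright₀ := mul_le_mul_of_nonneg_right hκτ' hT0.le
  refine mul_limLoss_le_expLogLik_sub hS hv₀ hθ hnT hn₀T ?_ ?_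
  · rw [Nat.cast_min]
    exact le_min (by linarith) (by linarith)
  · rw [Nat.cast_sub (max_le hnT hn₀T), Nat.cast_max, le_sub_comm]
    exact max_le (by linarith) (by linarith)

namespace SampleRegular

lemma logLik_sub_le (h : SampleRegular S v₀ κ c M T n₀ x ε) (hP : ParamBounds S R γ₀ Θ s₁ s₂ C)
    (hc : 0 ≤ c) (hn₀ : n₀ ≤ T) (hn : n ≤ T) {n' : ℕ} (hn' : n' ≤ T) {θ' : Param dx dz}
    (hθ : θ ∈ Θ) (hθ' : θ' ∈ Θ) :
    logLik R T n₀ γ₀ x ε θ n - logLik R T n₀ γ₀ x ε θ' n'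
      ≤ expLogLik S v₀ R T n₀ γ₀ θ n - expLogLik S v₀ R T n₀ γ₀ θ' n' + T * (6 * C * c / s₁) := by
  have hdev := abs_le.mp (h.abs_logLik_sub_expLogLik_le hc hn₀ hn hP.lower_pos
    (hP.le_variance θ hθ) (hP.sum_resWeight_le θ hθ))
  have hdev' := abs_le.mp (h.abs_logLik_sub_expLogLik_le hc hn₀ hn' hP.lower_pos
    (hP.le_variance θ' hθ') (hP.sum_resWeight_le θ' hθ'))
  have herr : T * (6 * C * c / s₁) = 3 * C * c * T / s₁ + 3 * C * c * T / s₁ := by ring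
  linarith

lemma logLik_sub_le_of_gap (h : SampleRegular S v₀ κ c M T n₀ x ε)
    (hP : ParamBounds S R γ₀ Θ s₁ s₂ C) (hc : 0 ≤ c) {q : ℝ} (hq : 0 ≤ q)
    (hcq : 2 * C * c ≤ q / 4) (hn₀ : n₀ ≤ T) (hn : n ≤ T)
    (hnκ : ((max n n₀ - min n n₀ : ℕ) : ℝ) ≤ κ * T) (hθ : θ ∈ Θ)
    (hgap : ∀ s, q / 2 ≤
      quadForm S (coefDev R γ₀ θ.1 (!s) s) - quadForm S (coefDev R γ₀ θ.1 s s)) :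
    logLik R T n₀ γ₀ x ε θ n - logLik R T n₀ γ₀ x ε θ n₀
      ≤ q * M / (8 * s₁) - q / (8 * s₂) * (max n n₀ - min n n₀ : ℕ) := by
  have hs₁ := hP.lower_pos
  have hθ0 : 0 < θ.2 := hs₁.trans_le (hP.le_variance θ hθ)
  have hdev := (abs_le.mp (h.abs_rss_sub_rss_sub_le hc hn₀ hn hnκ (hP.sum_resWeight_le θ hθ))).1
  set l : ℝ := ((max n n₀ - min n n₀ : ℕ) : ℝ)
  have hl : 0 ≤ l := Nat.cast_nonneg _
  have hnoise := mul_le_mul_of_nonneg_right hcq (show 0 ≤ l + M by positivity)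
  have hsignal := mul_le_mul_of_nonneg_left (hgap (n₀ ≤ n)) hl
  calc logLik R T n₀ γ₀ x ε θ n - logLik R T n₀ γ₀ x ε θ n₀
      = -((rss R T n₀ γ₀ x ε θ.1 n - rss R T n₀ γ₀ x ε θ.1 n₀) / (2 * θ.2)) := by
        unfold logLik
        ring
    _ ≤ -((l * (q / 2) - q / 4 * (l + M)) / (2 * θ.2)) :=
        neg_le_neg (div_le_div_of_nonneg_right (by linarith) (by positivity))
    _ = q * M / (8 * θ.2) - q * l / (8 * θ.2) := by ring
    _ ≤ q * M / (8 * s₁) - q * l / (8 * s₂) := by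
        gcongr
        · exact hP.le_variance θ hθ
        · exact hP.variance_le θ hθ
    _ = _ := by ring

lemma logLik_sub_le_of_short_window (h : SampleRegular S v₀ κ c M T n₀ x ε) (hS : S.PosDef)
    (hP : ParamBounds S R γ₀ Θ s₁ s₂ C) (hc : 0 ≤ c) {l : ℝ} (hn₀ : n₀ ≤ T) (hn : n ≤ T)
    (hnκ : ((max n n₀ - min n n₀ : ℕ) : ℝ) ≤ κ * T) (hnl : ((max n n₀ - min n n₀ : ℕ) : ℝ) ≤ l)
    (hθ : θ ∈ Θ) :
    logLik R T n₀ γ₀ x ε θ n₀ - logLik R T n₀ γ₀ x ε θ n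
      ≤ (l * C + 2 * C * c * (l + M)) / (2 * s₁) := by
  have hs₁ := hP.lower_pos
  have hC := hP.coef_pos
  have hdev := (abs_le.mp (h.abs_rss_sub_rss_sub_le hc hn₀ hn hnκ (hP.sum_resWeight_le θ hθ))).2
  set s := decide (n₀ ≤ n)
  have hjump : quadForm S (coefDev R γ₀ θ.1 (!s) s) - quadForm S (coefDev R γ₀ θ.1 s s) ≤ C := by
    linarith [quadForm_nonneg hS (coefDev R γ₀ θ.1 s s), hP.quadForm_le θ hθ (!s) s]
  have hsignal := mul_le_mul_of_nonneg_left hjump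
    (Nat.cast_nonneg (α := ℝ) (max n n₀ - min n n₀))
  have hl : 0 ≤ l := (Nat.cast_nonneg _).trans hnl
  have hsignal' := mul_le_mul_of_nonneg_right hnl hC.le
  have hnoise := mul_le_mul_of_nonneg_left hnl (show 0 ≤ 2 * C * c by positivity)
  calc logLik R T n₀ γ₀ x ε θ n₀ - logLik R T n₀ γ₀ x ε θ n
      = (rss R T n₀ γ₀ x ε θ.1 n - rss R T n₀ γ₀ x ε θ.1 n₀) / (2 * θ.2) := by
        unfold logLik
        ring
    _ ≤ (l * C + 2 * C * c * (l + M)) / (2 * s₁) :=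
        div_le_div₀ (by positivity) (by linarith) (by positivity)
          (mul_le_mul_of_nonneg_left (hP.le_variance θ hθ) zero_le_two)

end SampleRegular

end LikelihoodRatio

section LikelihoodSeparation

variable {dx dz : ℕ} {S : Matrix (Fin dx) (Fin dx) ℝ} {R : Matrix (Fin dx) (Fin dz) ℝ}
  {γ₀ : (Fin dx → ℝ) × (Fin dz → ℝ)} {v₀ κ ζ c s₁ s₂ C τ τ₀ : ℝ} {Θ B B' : Set (Param dx dz)}
  {θ θ' : Param dx dz} {M T : ℕ} {x : ℕ → Fin dx → ℝ} {ε : ℕ → ℝ}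

/-- The expected log likelihood favours the true parameter `(γ₀, v₀)`, by at least `4 ζ` per
observation over parameters outside `B` or breaks further than `κ` away, and by at most `ζ` over
parameters in `B'`. For parameters in `B`, each date between the break and the true one increases
the expected squared residual. -/
structure LossSeparated (S : Matrix (Fin dx) (Fin dx) ℝ) (R : Matrix (Fin dx) (Fin dz) ℝ)
    (γ₀ : (Fin dx → ℝ) × (Fin dz → ℝ)) (v₀ : ℝ) (Θ B B' : Set (Param dx dz)) (κ s₂ ζ : ℝ) :
    Prop where
  far_param : ∀ θ ∈ Θ, θ ∉ B → 4 * ζ ≤ limLoss S R γ₀ v₀ κ κ θ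
  far_break : 4 * ζ ≤ κ * quadForm S (R *ᵥ γ₀.2) / (8 * s₂)
  near : ∀ θ ∈ B', limLoss S R γ₀ v₀ 1 1 θ ≤ ζ
  gap : ∀ θ ∈ B, ∀ s, quadForm S (R *ᵥ γ₀.2) / 2 ≤
    quadForm S (coefDev R γ₀ θ.1 (!s) s) - quadForm S (coefDev R γ₀ θ.1 s s)

/-- The likelihood `lik θ τ` favours the truth `(θ₀, τ₀)`: by a factor `exp (3 ζ T)` over
parameters outside `B` or breaks further than `κ` away, by at most `exp (2 ζ T)` over parameters in
`B'`, and, for parameters in `B`, by a factor growing at rate `a` in the number of dates between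
the break and the true one, up to the factor `exp K`. -/
structure LikelihoodSeparated {α : Type*} (lik : α → ℝ → ℝ) (θ₀ : α) (τ₀ : ℝ) (Θ B B' : Set α)
    (κ ζ a K : ℝ) (T : ℕ) : Prop where
  far : ∀ θ ∈ Θ, ∀ τ ∈ Ioo (0 : ℝ) 1, θ ∉ B ∨ κ ≤ |τ - τ₀| →
    lik θ τ ≤ Real.exp (-(3 * ζ * T)) * lik θ₀ τ₀
  near : ∀ θ ∈ B', lik θ₀ τ₀ ≤ Real.exp (2 * ζ * T) * lik θ τ₀
  decay : ∀ θ ∈ B, ∀ τ ∈ Ioo (0 : ℝ) 1, |τ - τ₀| < κ →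
    lik θ τ ≤ Real.exp (K - a * (T * |τ - τ₀|)) * lik θ τ₀
  flat : ∀ θ ∈ B, ∀ τ ∈ Ioo (0 : ℝ) 1, T * |τ - τ₀| ≤ 1 → lik θ τ₀ ≤ Real.exp K * lik θ τ

lemma mulVec_ne_zero_of_rank_eq (hR : R.rank = dz) {δ : Fin dz → ℝ} (hδ : δ ≠ 0) : R *ᵥ δ ≠ 0 :=
  fun h => hδ (mulVec_injective_of_rank_eq hR (h.trans (Matrix.mulVec_zero R).symm))

lemma exists_lossSeparated (hS : S.PosDef) (hR : R.rank = dz) (hδ : γ₀.2 ≠ 0) (hv₀ : 0 < v₀)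
    (hΘ : IsCompact Θ) (hpos : ∀ θ ∈ Θ, 0 < θ.2) {U : Set (Param dx dz)} (hU : U ∈ 𝓝 (γ₀, v₀))
    (hs₂ : 0 < s₂) (hκ : 0 < κ) :
    ∃ B B' : Set (Param dx dz), ∃ ζ : ℝ, IsOpen B ∧ IsOpen B' ∧ (γ₀, v₀) ∈ B' ∧ B' ⊆ B ∧ B ⊆ U ∧
      0 < ζ ∧ LossSeparated S R γ₀ v₀ Θ B B' κ s₂ ζ := by
  have hjump := mulVec_ne_zero_of_rank_eq hR hδ
  obtain ⟨B, hBsub, hBopen, hB₀⟩ := mem_nhds_iff.mp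
    (inter_mem hU (eventually_quadForm_gap (v₀ := v₀) hS hjump))
  obtain ⟨z, hz, hzloss⟩ := exists_limLoss_lower_bound hS hR hv₀ hΘ hpos hBopen hB₀ hκ
  have hq := quadForm_pos hS hjump
  set ζ := min z (κ * quadForm S (R *ᵥ γ₀.2) / (8 * s₂)) / 4 with hζ
  have hζ4 : 4 * ζ = min z (κ * quadForm S (R *ᵥ γ₀.2) / (8 * s₂)) := by
    rw [hζ]
    ring
  have hζ0 : 0 < ζ := by positivity
  have hcont : ∀ᶠ θ in 𝓝 ((γ₀, v₀) : Param dx dz), limLoss S R γ₀ v₀ 1 1 θ < ζ :=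
    (continuousAt_limLoss hv₀ hv₀).eventually_lt_const ((limLoss_true hv₀).trans_lt hζ0)
  obtain ⟨B', hB'sub, hB'open, hB'₀⟩ := mem_nhds_iff.mp (inter_mem (hBopen.mem_nhds hB₀) hcont)
  exact ⟨B, B', ζ, hBopen, hB'open, hB'₀, fun θ hθ => (hB'sub hθ).1, fun θ hθ => (hBsub hθ).1, hζ0,
    { far_param := fun θ hθ hθB => hζ4.trans_le ((min_le_left _ _).trans (hzloss θ hθ hθB))
      far_break := hζ4.trans_le (min_le_right _ _)
      near := fun θ hθ => (hB'sub hθ).2.le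
      gap := fun θ hθ => (hBsub hθ).2 }⟩

lemma normalLik_le_exp_mul (hθ : 0 < θ.2) (hθ' : 0 < θ'.2) {τ' d : ℝ}
    (h : logLik R T (strictFloor (τ₀ * T)) γ₀ x ε θ (strictFloor (τ * T))
      - logLik R T (strictFloor (τ₀ * T)) γ₀ x ε θ' (strictFloor (τ' * T)) ≤ d) :
    normalLik R T (fun t => regMean R T τ₀ γ₀ t (x t) + ε t) x θ τ
      ≤ Real.exp d * normalLik R T (fun t => regMean R T τ₀ γ₀ t (x t) + ε t) x θ' τ' := by
  rw [normalLik_eq_exp_logLik R T γ₀ τ₀ τ x ε hθ, normalLik_eq_exp_logLik R T γ₀ τ₀ τ' x ε hθ',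
    ← Real.exp_add]
  exact Real.exp_le_exp.mpr (sub_le_iff_le_add.mp h)

lemma LossSeparated.mul_le_expLogLik_sub (hL : LossSeparated S R γ₀ v₀ Θ B B' κ s₂ ζ)
    (hP : ParamBounds S R γ₀ Θ s₁ s₂ C) (hS : S.PosDef) (hv₀ : 0 < v₀) (hκτ : 3 * κ ≤ τ₀)
    (hκτ' : 3 * κ ≤ 1 - τ₀) (hκ : 0 < κ) (hT : 2 ≤ κ * T) (hθ : θ ∈ Θ) (hτ : τ ∈ Ioo (0 : ℝ) 1)
    (hfar : θ ∉ B ∨ κ ≤ |τ - τ₀|) :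
    T * (4 * ζ) ≤ expLogLik S v₀ R T (strictFloor (τ₀ * T)) γ₀ (γ₀, v₀) (strictFloor (τ₀ * T))
      - expLogLik S v₀ R T (strictFloor (τ₀ * T)) γ₀ θ (strictFloor (τ * T)) := by
  rcases le_or_gt κ |τ - τ₀| with hbreak | hbreak
  · exact (mul_le_mul_of_nonneg_left hL.far_break T.cast_nonneg).trans
      (hP.mul_le_expLogLik_sub_of_far_break hS hv₀ hκτ hκτ' hκ hT hθ hτ hbreak)
  · exact (mul_le_mul_of_nonneg_left (hL.far_param θ hθ (hfar.resolve_right hbreak.not_ge))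
      T.cast_nonneg).trans (mul_limLoss_le_expLogLik_sub_of_near_break hS hv₀
        (hP.lower_pos.trans_le (hP.le_variance θ hθ)) hκτ hκτ' hκ hT hτ hbreak)

lemma SampleRegular.likelihoodSeparated
    (h : SampleRegular S v₀ (2 * κ) c M T (strictFloor (τ₀ * T)) x ε)
    (hL : LossSeparated S R γ₀ v₀ Θ B B' κ s₂ ζ) (hP : ParamBounds S R γ₀ Θ s₁ s₂ C)
    (hS : S.PosDef) (hv₀ : 0 < v₀) (hBΘ : B ⊆ Θ) (hB'B : B' ⊆ B) (hθ₀ : (γ₀, v₀) ∈ Θ)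
    (hκτ : 3 * κ ≤ τ₀) (hκτ' : 3 * κ ≤ 1 - τ₀) (hκ : 0 < κ) (hT : 2 ≤ κ * T) (hc : 0 ≤ c)
    (hcζ : 6 * C * c / s₁ ≤ ζ) (hcq : 2 * C * c ≤ quadForm S (R *ᵥ γ₀.2) / 4) {K : ℝ}
    (hdecay : quadForm S (R *ᵥ γ₀.2) / (8 * s₂)
      + quadForm S (R *ᵥ γ₀.2) * M / (8 * s₁) ≤ K)
    (hflat : (2 * C + 2 * C * c * (2 + M)) / (2 * s₁) ≤ K) :
    LikelihoodSeparated (normalLik R T (fun t => regMean R T τ₀ γ₀ t (x t) + ε t) x) (γ₀, v₀) τ₀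
      Θ B B' κ ζ (quadForm S (R *ᵥ γ₀.2) / (8 * s₂)) K T := by
  have hpos (θ : Param dx dz) (hθ : θ ∈ Θ) : 0 < θ.2 := hP.lower_pos.trans_le (hP.le_variance θ hθ)
  have hq := quadForm_nonneg hS (R *ᵥ γ₀.2)
  have hs₂ := hP.upper_pos
  have hT0 : (0 : ℝ) < T := pos_of_mul_pos_right (two_pos.trans_le hT) hκ.le
  have hTpos : 0 < T := by exact_mod_cast hT0
  have hτ₀ : 0 < τ₀ := by linarith
  have hn₀ : strictFloor (τ₀ * T) ≤ T := strictFloor_mul_le (by linarith) T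
  have hnoise := mul_le_mul_of_nonneg_left hcζ hT0.le
  have hlen (τ : ℝ) (hτ : τ ∈ Ioo (0 : ℝ) 1) := abs_le.mp (abs_windowLength_sub_le hτ.1 hτ₀ hTpos)
  refine ⟨fun θ hθ τ hτ hfar => ?far, fun θ hθ => ?near, fun θ hθ τ hτ hclose => ?decay,
    fun θ hθ τ hτ hclose => ?flat⟩
  case far =>
    have hloss := hL.mul_le_expLogLik_sub hP hS hv₀ hκτ hκτ' hκ hT hθ hτ hfar
    have hlik := h.logLik_sub_le hP hc hn₀ (strictFloor_mul_le hτ.2.le T) hn₀ hθ hθ₀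
    exact normalLik_le_exp_mul (hpos θ hθ) hv₀ (by linarith)
  case near =>
    have hθΘ := hBΘ (hB'B hθ)
    have hloss := (expLogLik_sub_le (R := R) (γ₀ := γ₀) hS hv₀ (hpos θ hθΘ) hTpos hn₀).trans
      (mul_le_mul_of_nonneg_left (hL.near θ hθ) hT0.le)
    have hlik := h.logLik_sub_le hP hc hn₀ hn₀ hn₀ hθ₀ hθΘ
    exact normalLik_le_exp_mul hv₀ (hpos θ hθΘ) (by linarith)
  case decay =>
    have hlik := h.logLik_sub_le_of_gap hP hc hq hcq hn₀ (strictFloor_mul_le hτ.2.le T)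
      (by linarith [(hlen τ hτ).2, mul_lt_mul_of_pos_left hclose hT0]) (hBΘ hθ) (hL.gap θ hθ)
    have hrate := mul_le_mul_of_nonneg_left (hlen τ hτ).1
      (show 0 ≤ quadForm S (R *ᵥ γ₀.2) / (8 * s₂) by positivity)
    exact normalLik_le_exp_mul (hpos θ (hBΘ hθ)) (hpos θ (hBΘ hθ)) (by linarith)
  case flat =>
    have hshort := (hlen τ hτ).2
    exact normalLik_le_exp_mul (hpos θ (hBΘ hθ)) (hpos θ (hBΘ hθ))
      ((h.logLik_sub_le_of_short_window hS hP hc hn₀ (strictFloor_mul_le hτ.2.le T)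
        (by linarith) (by linarith) (hBΘ hθ)).trans hflat)

lemma exists_likelihoodSeparated (hS : S.PosDef) (hR : R.rank = dz) (hδ : γ₀.2 ≠ 0) (hv₀ : 0 < v₀)
    (hΘ : IsCompact Θ) (hpos : ∀ θ ∈ Θ, 0 < θ.2) (hΘ₀ : Θ ∈ 𝓝 (γ₀, v₀)) {U : Set (Param dx dz)}
    (hU : U ∈ 𝓝 (γ₀, v₀)) (hκτ : 3 * κ ≤ τ₀) (hκτ' : 3 * κ ≤ 1 - τ₀) (hκ : 0 < κ) :
    ∃ B B' : Set (Param dx dz), ∃ ζ a c : ℝ, IsOpen B ∧ IsOpen B' ∧ (γ₀, v₀) ∈ B' ∧ B' ⊆ B ∧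
      B ⊆ U ∩ Θ ∧ 0 < ζ ∧ 0 < a ∧ 0 < c ∧ ∀ M : ℕ, ∃ K : ℝ, ∀ (T : ℕ) (x : ℕ → Fin dx → ℝ)
        (ε : ℕ → ℝ), 2 ≤ κ * T → SampleRegular S v₀ (2 * κ) c M T (strictFloor (τ₀ * T)) x ε →
        LikelihoodSeparated (normalLik R T (fun t => regMean R T τ₀ γ₀ t (x t) + ε t) x) (γ₀, v₀)
          τ₀ Θ B B' κ ζ a K T := by
  have hθ₀ := mem_of_mem_nhds hΘ₀
  obtain ⟨s₁, s₂, C, hP⟩ :=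
    exists_paramBounds (S := S) (R := R) (γ₀ := γ₀) hΘ hpos ⟨_, hθ₀⟩
  have hs₁ := hP.lower_pos
  have hs₂ := hP.upper_pos
  have hC := hP.coef_pos
  obtain ⟨B, B', ζ, hB, hB', hθ₀B', hB'B, hBU, hζ, hL⟩ :=
    exists_lossSeparated hS hR hδ hv₀ hΘ hpos (inter_mem hU hΘ₀) hs₂ hκ
  have hq := quadForm_pos hS (mulVec_ne_zero_of_rank_eq hR hδ)
  set c := min (ζ * s₁ / (6 * C)) (quadForm S (R *ᵥ γ₀.2) / (8 * C))
  have hc0 : 0 < c := by positivity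
  have hcζ : 6 * C * c / s₁ ≤ ζ := by
    rw [div_le_iff₀ hs₁, mul_comm, ← le_div_iff₀ (by positivity)]
    exact min_le_left _ _
  have hcq : 2 * C * c ≤ quadForm S (R *ᵥ γ₀.2) / 4 := by
    rw [mul_comm, ← le_div_iff₀ (by positivity)]
    exact (min_le_right _ _).trans_eq (by ring)
  exact ⟨B, B', ζ, _, c, hB, hB', hθ₀B', hB'B, hBU, hζ, div_pos hq (by positivity), hc0, fun M =>
    ⟨max _ _, fun T x ε hT h => h.likelihoodSeparated hL hP hS hv₀ (fun θ hθ => (hBU hθ).2) hB'B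
      hθ₀ hκτ hκτ' hκ hT hc0.le hcζ hcq (le_max_left _ _) (le_max_right _ _)⟩⟩

end LikelihoodSeparation

section Integration

lemma integral_exp_neg_mul_abs_sub {b : ℝ} (hb : 0 < b) (τ₀ : ℝ) :
    ∫ τ : ℝ, Real.exp (-(b * |τ - τ₀|)) = 2 / b := by
  have hhalf : ∫ τ in Ioi (0 : ℝ), Real.exp (-(b * τ)) = 1 / b := by
    simpa [neg_mul] using integral_exp_mul_Ioi (neg_neg_of_pos hb) 0
  rw [integral_sub_right_eq_self (fun τ => Real.exp (-(b * |τ|))) τ₀,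
    integral_comp_abs (f := fun τ => Real.exp (-(b * τ))), hhalf, mul_one_div]

lemma integrable_exp_neg_mul_abs_sub {b : ℝ} (hb : 0 < b) (τ₀ : ℝ) :
    Integrable fun τ : ℝ => Real.exp (-(b * |τ - τ₀|)) :=
  .of_integral_ne_zero (by rw [integral_exp_neg_mul_abs_sub hb]; positivity)

variable {α β : Type*} [MeasurableSpace α] [MeasurableSpace β] {ν : Measure α} {ρ : Measure β}
  [SFinite ν] [SFinite ρ] {f f' p : α × β → ℝ} {g : α → ℝ} {k : β → ℝ} {A : Set β}

lemma setIntegral_integral_mono (hf : Integrable f (ν.prod ρ)) (hf' : Integrable f' (ν.prod ρ))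
    (hA : MeasurableSet A) (h : ∀ s, ∀ t ∈ A, f (s, t) ≤ f' (s, t)) :
    ∫ t in A, ∫ s, f (s, t) ∂ν ∂ρ ≤ ∫ t in A, ∫ s, f' (s, t) ∂ν ∂ρ := by
  refine setIntegral_mono_ae_restrict hf.integral_prod_right.integrableOn
    hf'.integral_prod_right.integrableOn ?_
  filter_upwards [ae_restrict_of_ae hf.prod_left_ae, ae_restrict_of_ae hf'.prod_left_ae,
    ae_restrict_mem hA] with t hft hft' ht
  exact integral_mono hft hft' fun s => h s t ht

lemma setIntegral_integral_le_of_le_mul_add (hf : Integrable f (ν.prod ρ))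
    (hp : Integrable p (ν.prod ρ)) (hp0 : ∀ z, 0 ≤ p z) (hg : Integrable g ν)
    (hg0 : ∀ s, 0 ≤ g s) (hk : Integrable k ρ) (hk0 : ∀ t, 0 ≤ k t) (hA : MeasurableSet A)
    (h : ∀ s, ∀ t ∈ A, f (s, t) ≤ g s * k t + p (s, t)) :
    ∫ t in A, ∫ s, f (s, t) ∂ν ∂ρ ≤ (∫ s, g s ∂ν) * (∫ t, k t ∂ρ) + ∫ z, p z ∂(ν.prod ρ) := by
  have hgk : Integrable (fun z : α × β => g z.1 * k z.2) (ν.prod ρ) := hg.mul_prod hk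
  calc ∫ t in A, ∫ s, f (s, t) ∂ν ∂ρ
      ≤ ∫ t in A, ∫ s, (g s * k t + p (s, t)) ∂ν ∂ρ :=
        setIntegral_integral_mono hf (hgk.add hp) hA h
    _ ≤ ∫ t, ∫ s, (g s * k t + p (s, t)) ∂ν ∂ρ :=
        setIntegral_le_integral (hgk.add hp).integral_prod_right <| ae_of_all _ fun t =>
          integral_nonneg fun s => add_nonneg (mul_nonneg (hg0 s) (hk0 t)) (hp0 _)
    _ = ∫ z, (g z.1 * k z.2 + p z) ∂(ν.prod ρ) := (integral_prod_symm _ (hgk.add hp)).symm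
    _ = _ := by rw [integral_add hgk hp, integral_prod_mul]

lemma mul_integral_le_setIntegral_integral (hf : Integrable f (ν.prod ρ)) (hg : Integrable g ν)
    (hk : Integrable k ρ) (hA : MeasurableSet A) (h : ∀ s, ∀ t ∈ A, g s * k t ≤ f (s, t)) :
    (∫ s, g s ∂ν) * (∫ t in A, k t ∂ρ) ≤ ∫ t in A, ∫ s, f (s, t) ∂ν ∂ρ := by
  refine le_of_eq_of_le ?_ (setIntegral_integral_mono (hg.mul_prod hk) hf hA h)
  simp only [integral_mul_const, integral_const_mul]

end Integration

section PosteriorMass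

variable {α : Type*} [MeasurableSpace α] {ν : Measure α} {lik : α → ℝ → ℝ}
  {prior : α × ℝ → ℝ} {θ₀ : α} {τ₀ κ ζ a K lo hi m : ℝ} {Θ B B' : Set α} {H I : Set ℝ} {T : ℕ}

/-- A likelihood `lik` and a prior probability density `prior` on `Θ × H` to which Bayes' rule
applies. -/
structure BayesModel (ν : Measure α) (lik : α → ℝ → ℝ) (prior : α × ℝ → ℝ) (Θ : Set α)
    (H : Set ℝ) : Prop where
  lik_nonneg : ∀ θ τ, 0 ≤ lik θ τ
  lik_integrableOn : ∀ τ, IntegrableOn (fun θ => lik θ τ) Θ ν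
  prior_nonneg : ∀ z, 0 ≤ prior z
  prior_total_mass : ∫ z, prior z ∂(ν.prod volume) = 1
  prior_supported : ∀ z ∉ Θ ×ˢ H, prior z = 0
  integrable_mul : Integrable (fun z : α × ℝ => lik z.1 z.2 * prior z) (ν.prod volume)

namespace BayesModel

lemma mul_nonneg (h : BayesModel ν lik prior Θ H) (θ : α) (τ : ℝ) :
    0 ≤ lik θ τ * prior (θ, τ) :=
  _root_.mul_nonneg (h.lik_nonneg θ τ) (h.prior_nonneg _)

lemma integrable_prior (h : BayesModel ν lik prior Θ H) : Integrable prior (ν.prod volume) :=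
  .of_integral_ne_zero (h.prior_total_mass.trans_ne one_ne_zero)

lemma evidence_pos [SFinite ν] (h : BayesModel ν lik prior Θ H)
    (hlik : ∀ θ ∈ Θ, ∀ τ, 0 < lik θ τ) : 0 < ∫ τ in H, ∫ θ, lik θ τ * prior (θ, τ) ∂ν := by
  have hprior : 0 < (ν.prod volume) (Function.support prior) :=
    (integral_pos_iff_support_of_nonneg h.prior_nonneg h.integrable_prior).mp
      (zero_lt_one.trans_eq h.prior_total_mass.symm)
  have hsupport : Function.support prior ⊆
      Function.support fun z : α × ℝ => lik z.1 z.2 * prior z := fun z hz =>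
    mul_ne_zero (hlik _ (not_imp_comm.mp (h.prior_supported z) hz).1 _).ne' hz
  have hvanish (τ : ℝ) (hτ : τ ∉ H) : ∫ θ, lik θ τ * prior (θ, τ) ∂ν = 0 :=
    integral_eq_zero_of_ae <| ae_of_all _ fun θ =>
      mul_eq_zero_of_right _ (h.prior_supported (θ, τ) fun hz => hτ hz.2)
  rw [setIntegral_eq_integral_of_forall_compl_eq_zero hvanish,
    ← integral_prod_symm _ h.integrable_mul]
  exact (integral_pos_iff_support_of_nonneg (fun z => h.mul_nonneg z.1 z.2) h.integrable_mul).mpr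
    (hprior.trans_le (measure_mono hsupport))

end BayesModel

lemma le_mul_abs_sub_of_notMem_Ioo (hT : 0 < T) {τ : ℝ}
    (hτ : τ ∉ Ioo (τ₀ - m / T) (τ₀ + m / T)) : m ≤ T * |τ - τ₀| := by
  rw [← Real.ball_eq_Ioo, Metric.mem_ball, Real.dist_eq, not_lt] at hτ
  exact (div_le_iff₀' (Nat.cast_pos.mpr hT)).mp hτ

namespace LikelihoodSeparated

lemma mul_measureReal_le (hsep : LikelihoodSeparated lik θ₀ τ₀ Θ B B' κ ζ a K T)
    (h : BayesModel ν lik prior Θ H) (hB' : MeasurableSet B') (hB'B : B' ⊆ B) (hBΘ : B ⊆ Θ)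
    (hfin : ν B' ≠ ⊤) :
    lik θ₀ τ₀ * ν.real B' ≤ Real.exp (2 * ζ * T) * ∫ θ in B, lik θ τ₀ ∂ν := by
  have hint := (h.lik_integrableOn τ₀).mono_set hBΘ
  calc lik θ₀ τ₀ * ν.real B' = ∫ _ in B', lik θ₀ τ₀ ∂ν := by
        rw [setIntegral_const, smul_eq_mul, mul_comm]
    _ ≤ ∫ θ in B', Real.exp (2 * ζ * T) * lik θ τ₀ ∂ν :=
        setIntegral_mono_on (integrableOn_const hfin) ((hint.mono_set hB'B).const_mul _) hB'
          hsep.near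
    _ = Real.exp (2 * ζ * T) * ∫ θ in B', lik θ τ₀ ∂ν := integral_const_mul _ _
    _ ≤ Real.exp (2 * ζ * T) * ∫ θ in B, lik θ τ₀ ∂ν :=
        mul_le_mul_of_nonneg_left (setIntegral_mono_set hint
          (ae_of_all _ fun θ => h.lik_nonneg θ τ₀) hB'B.eventuallyLE) (Real.exp_pos _).le

lemma mul_le_evidence [SFinite ν] (hsep : LikelihoodSeparated lik θ₀ τ₀ Θ B B' κ ζ a K T)
    (h : BayesModel ν lik prior Θ H) (hB : MeasurableSet B) (hBΘ : B ⊆ Θ) (hH : MeasurableSet H)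
    (hH01 : H ⊆ Ioo 0 1) (hlo : ∀ θ ∈ B, ∀ τ ∈ I, lo ≤ prior (θ, τ)) (hlo0 : 0 ≤ lo)
    (hI : MeasurableSet I) (hIH : I ⊆ H) (hIT : ∀ τ ∈ I, T * |τ - τ₀| ≤ 1) :
    (∫ θ in B, lik θ τ₀ ∂ν) * (volume.real I * (lo * Real.exp (-K))) ≤
      ∫ τ in H, ∫ θ, lik θ τ * prior (θ, τ) ∂ν := by
  have hIfin : volume I ≠ ⊤ := ((measure_mono (hIH.trans hH01)).trans_lt measure_Ioo_lt_top).ne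
  have hk : Integrable (I.indicator fun _ : ℝ => lo * Real.exp (-K)) :=
    (integrable_indicator_iff hI).mpr (integrableOn_const hIfin)
  have hg : Integrable (B.indicator fun θ => lik θ τ₀) ν :=
    (integrable_indicator_iff hB).mpr ((h.lik_integrableOn τ₀).mono_set hBΘ)
  have hflat (θ : α) (hθ : θ ∈ B) (τ : ℝ) (hτ : τ ∈ I) :
      lik θ τ₀ * (lo * Real.exp (-K)) ≤ lik θ τ * prior (θ, τ) :=
    calc lik θ τ₀ * (lo * Real.exp (-K))
        ≤ Real.exp K * lik θ τ * (lo * Real.exp (-K)) := by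
          gcongr
          exact hsep.flat θ hθ τ (hH01 (hIH hτ)) (hIT τ hτ)
      _ = lik θ τ * lo := by
          rw [Real.exp_neg]
          field_simp
      _ ≤ lik θ τ * prior (θ, τ) :=
          mul_le_mul_of_nonneg_left (hlo θ hθ τ hτ) (h.lik_nonneg θ τ)
  have hevidence := mul_integral_le_setIntegral_integral h.integrable_mul hg hk hH fun θ τ _ => by
    by_cases hθ : θ ∈ B
    · by_cases hτ : τ ∈ I
      · simpa only [indicator_of_mem hθ, indicator_of_mem hτ] using hflat θ hθ τ hτ
      · simpa only [indicator_of_notMem hτ, mul_zero] using h.mul_nonneg θ τ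
    · simpa only [indicator_of_notMem hθ, zero_mul] using h.mul_nonneg θ τ
  rwa [integral_indicator hB, setIntegral_indicator hI, inter_eq_right.mpr hIH,
    setIntegral_const, smul_eq_mul] at hevidence

lemma mul_prior_le (hsep : LikelihoodSeparated lik θ₀ τ₀ Θ B B' κ ζ a K T)
    (h : BayesModel ν lik prior Θ H) (hH01 : H ⊆ Ioo 0 1)
    (hhi : ∀ θ ∈ B, ∀ τ ∈ H, |τ - τ₀| < κ → prior (θ, τ) ≤ hi) (hhi0 : 0 ≤ hi) (ha : 0 ≤ a)
    (θ : α) {τ : ℝ} (hτ : τ ∈ H) (hm : m ≤ T * |τ - τ₀|) :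
    lik θ τ * prior (θ, τ) ≤
      B.indicator (fun θ => lik θ τ₀) θ *
        (hi * Real.exp (K - a / 2 * m) * Real.exp (-(a / 2 * T * |τ - τ₀|))) +
      Real.exp (-(3 * ζ * T)) * lik θ₀ τ₀ * prior (θ, τ) := by
  have hB0 : 0 ≤ B.indicator (fun θ => lik θ τ₀) θ :=
    indicator_nonneg (fun θ _ => h.lik_nonneg θ τ₀) θ
  have hp := h.prior_nonneg (θ, τ)
  have hl := h.lik_nonneg θ₀ τ₀
  by_cases hΘ : θ ∈ Θ
  · by_cases hfar : θ ∉ B ∨ κ ≤ |τ - τ₀|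
    · exact le_add_of_nonneg_of_le (by positivity)
        (mul_le_mul_of_nonneg_right (hsep.far θ hΘ τ (hH01 hτ) hfar) hp)
    obtain ⟨hθ, hτκ⟩ : θ ∈ B ∧ |τ - τ₀| < κ := by simpa using hfar
    refine le_add_of_le_of_nonneg ?_ (by positivity)
    have hexp : Real.exp (K - a * (T * |τ - τ₀|)) ≤
        Real.exp (K - a / 2 * m) * Real.exp (-(a / 2 * T * |τ - τ₀|)) := by
      rw [← Real.exp_add, Real.exp_le_exp]
      linarith [mul_le_mul_of_nonneg_left hm (div_nonneg ha zero_le_two)]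
    calc lik θ τ * prior (θ, τ)
        ≤ Real.exp (K - a * (T * |τ - τ₀|)) * lik θ τ₀ * hi :=
          mul_le_mul (hsep.decay θ hθ τ (hH01 hτ) hτκ) (hhi θ hθ τ hτ hτκ) hp
            (mul_nonneg (Real.exp_pos _).le (h.lik_nonneg θ τ₀))
      _ ≤ Real.exp (K - a / 2 * m) * Real.exp (-(a / 2 * T * |τ - τ₀|)) * lik θ τ₀ * hi := by
          gcongr
          exact h.lik_nonneg θ τ₀
      _ = _ := by
          rw [indicator_of_mem hθ]
          ring
  · rw [h.prior_supported _ fun hz => hΘ hz.1]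
    simpa only [mul_zero, add_zero] using mul_nonneg hB0 (by positivity)

lemma setIntegral_diff_le [SFinite ν] (hsep : LikelihoodSeparated lik θ₀ τ₀ Θ B B' κ ζ a K T)
    (h : BayesModel ν lik prior Θ H) (hB : MeasurableSet B) (hBΘ : B ⊆ Θ) (hH : MeasurableSet H)
    (hH01 : H ⊆ Ioo 0 1) (hhi : ∀ θ ∈ B, ∀ τ ∈ H, |τ - τ₀| < κ → prior (θ, τ) ≤ hi)
    (hhi0 : 0 ≤ hi) (ha : 0 < a) (hT : 0 < T) :
    ∫ τ in H \ Ioo (τ₀ - m / T) (τ₀ + m / T), ∫ θ, lik θ τ * prior (θ, τ) ∂ν ≤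
      (∫ θ in B, lik θ τ₀ ∂ν) * (hi * Real.exp (K - a / 2 * m) * (2 / (a / 2 * T))) +
        Real.exp (-(3 * ζ * T)) * lik θ₀ τ₀ := by
  have : (0 : ℝ) < T := Nat.cast_pos.mpr hT
  have hdominated := setIntegral_integral_le_of_le_mul_add h.integrable_mul
    (h.integrable_prior.const_mul (Real.exp (-(3 * ζ * T)) * lik θ₀ τ₀))
    (fun z => mul_nonneg (mul_nonneg (Real.exp_pos _).le (h.lik_nonneg _ _)) (h.prior_nonneg z))
    ((integrable_indicator_iff hB).mpr ((h.lik_integrableOn τ₀).mono_set hBΘ))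
    (indicator_nonneg fun θ _ => h.lik_nonneg θ τ₀)
    ((integrable_exp_neg_mul_abs_sub (show 0 < a / 2 * T by positivity) τ₀).const_mul
      (hi * Real.exp (K - a / 2 * m)))
    (fun τ => by positivity) (hH.diff measurableSet_Ioo) fun θ τ hτ =>
      hsep.mul_prior_le h hH01 hhi hhi0 ha.le θ hτ.1 (le_mul_abs_sub_of_notMem_Ioo hT hτ.2)
  rwa [integral_indicator hB, integral_const_mul, integral_const_mul,
    integral_exp_neg_mul_abs_sub (by positivity), h.prior_total_mass, mul_one] at hdominated

lemma setIntegral_diff_div_le [SFinite ν]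
    (hsep : LikelihoodSeparated lik θ₀ τ₀ Θ B B' κ ζ a K T) (h : BayesModel ν lik prior Θ H)
    (hlik : 0 < lik θ₀ τ₀) (hB : MeasurableSet B) (hBΘ : B ⊆ Θ) (hB' : MeasurableSet B')
    (hB'B : B' ⊆ B) (hvol : 0 < ν.real B') (hH : MeasurableSet H) (hH01 : H ⊆ Ioo 0 1)
    (hbound : ∀ θ ∈ B, ∀ τ ∈ H, |τ - τ₀| < κ → lo ≤ prior (θ, τ) ∧ prior (θ, τ) ≤ hi)
    (hlo : 0 < lo) (hhi : 0 ≤ hi) (ha : 0 < a) (hT : 0 < T) (hI : MeasurableSet I) (hIH : I ⊆ H)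
    (hIvol : volume.real I = 1 / T) (hIκ : ∀ τ ∈ I, |τ - τ₀| < κ)
    (hIT : ∀ τ ∈ I, T * |τ - τ₀| ≤ 1) :
    (∫ τ in H \ Ioo (τ₀ - m / T) (τ₀ + m / T), ∫ θ, lik θ τ * prior (θ, τ) ∂ν) /
        ∫ τ in H, ∫ θ, lik θ τ * prior (θ, τ) ∂ν ≤
      4 * hi * Real.exp (2 * K) / (a * lo) * Real.exp (-(a / 2 * m)) +
        Real.exp K / (lo * ν.real B') * (T * Real.exp (-(ζ * T))) := by
  have : (0 : ℝ) < T := Nat.cast_pos.mpr hT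
  have hnear := hsep.mul_measureReal_le h hB' hB'B hBΘ (ENNReal.toReal_pos_iff.mp hvol).2.ne
  have hnum := hsep.setIntegral_diff_le (m := m) h hB hBΘ hH hH01
    (fun θ hθ τ hτ hκ => (hbound θ hθ τ hτ hκ).2) hhi ha hT
  have hden := hsep.mul_le_evidence h hB hBΘ hH hH01
    (fun θ hθ τ hτ => (hbound θ hθ τ (hIH hτ) (hIκ τ hτ)).1) hlo.le hI hIH hIT
  set Z := ∫ θ in B, lik θ τ₀ ∂ν
  have hZ : 0 < Z := pos_of_mul_pos_right ((mul_pos hlik hvol).trans_le hnear) (Real.exp_pos _).le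
  have hfar : Real.exp (-(3 * ζ * T)) * lik θ₀ τ₀ ≤ Real.exp (-(ζ * T)) / ν.real B' * Z :=
    calc Real.exp (-(3 * ζ * T)) * lik θ₀ τ₀
        ≤ Real.exp (-(3 * ζ * T)) * (Real.exp (2 * ζ * T) * Z / ν.real B') := by
          gcongr
          exact (le_div_iff₀ hvol).mpr hnear
      _ = Real.exp (-(3 * ζ * T) + 2 * ζ * T) / ν.real B' * Z := by
          rw [Real.exp_add]
          ring
      _ = Real.exp (-(ζ * T)) / ν.real B' * Z := by
          congr 3
          ring
  rw [hIvol] at hden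
  refine (div_le_div₀ (by positivity) (hnum.trans (add_le_add_right hfar _)) (by positivity)
    hden).trans_eq ?_
  rw [sub_eq_add_neg, Real.exp_add, Real.exp_neg K, two_mul K, Real.exp_add]
  field_simp
  ring

end LikelihoodSeparated

end PosteriorMass

section Likelihood

variable {dx dz : ℕ} {R : Matrix (Fin dx) (Fin dz) ℝ} {T : ℕ} {y : ℕ → ℝ} {x : ℕ → Fin dx → ℝ}
  {Θ : Set (Param dx dz)}

lemma measurable_strictFloor : Measurable strictFloor :=
  (measurable_of_countable fun n : ℕ => n - 1).comp Nat.measurable_ceil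

lemma measurable_regMean (t : ℕ) (v : Fin dx → ℝ) :
    Measurable fun p : Param dx dz × ℝ => regMean R T p.2 p.1.1 t v := by
  have hdot {n : ℕ} (w : Fin n → ℝ) : Measurable (w ⬝ᵥ ·) := by
    unfold dotProduct
    fun_prop
  have hbreak : MeasurableSet {p : Param dx dz × ℝ | strictFloor (p.2 * T) ≤ t} :=
    measurableSet_le (measurable_strictFloor.comp (measurable_snd.mul_const _)) measurable_const
  exact ((hdot v).comp (by fun_prop)).add
    (Measurable.ite hbreak ((hdot _).comp (by fun_prop)) measurable_const)

lemma measurable_normalLik :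
    Measurable fun p : Param dx dz × ℝ => normalLik R T y x p.1 p.2 := by
  refine Finset.measurable_prod _ fun t _ => ?_
  have := measurable_regMean (R := R) (T := T) t (x t)
  fun_prop

lemma normalLik_nonneg (θ : Param dx dz) (τ : ℝ) : 0 ≤ normalLik R T y x θ τ :=
  Finset.prod_nonneg fun t _ => by positivity

lemma normalLik_pos {θ : Param dx dz} (hθ : 0 < θ.2) (τ : ℝ) : 0 < normalLik R T y x θ τ :=
  Finset.prod_pos fun t _ => by positivity

lemma normalLik_le {s : ℝ} (hs : 0 < s) {θ : Param dx dz} (hθ : s ≤ θ.2) (τ : ℝ) :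
    normalLik R T y x θ τ ≤ (1 / √(2 * Real.pi * s)) ^ T := by
  have hθ0 : 0 < θ.2 := hs.trans_le hθ
  refine (Finset.prod_le_prod (fun t _ => by positivity) fun t _ => ?_).trans_eq
    (by rw [Finset.prod_const, Finset.card_range])
  refine (mul_le_of_le_one_right (by positivity) (Real.exp_le_one_iff.mpr ?_)).trans ?_
  · exact div_nonpos_of_nonpos_of_nonneg (neg_nonpos.mpr (sq_nonneg _)) (by positivity)
  · gcongr

lemma exists_normalLik_le (hΘ : IsCompact Θ) (hpos : ∀ θ ∈ Θ, 0 < θ.2) :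
    ∃ b : ℝ, ∀ θ ∈ Θ, ∀ τ, normalLik R T y x θ τ ≤ b := by
  rcases Θ.eq_empty_or_nonempty with rfl | hne
  · exact ⟨0, fun θ hθ => hθ.elim⟩
  · obtain ⟨θ₁, hθ₁, hmin⟩ := hΘ.exists_isMinOn hne continuous_snd.continuousOn
    exact ⟨_, fun θ hθ τ => normalLik_le (hpos θ₁ hθ₁) (hmin hθ) τ⟩

end Likelihood

section Prior

variable {dx dz : ℕ} {R : Matrix (Fin dx) (Fin dz) ℝ} {T : ℕ} {y : ℕ → ℝ} {x : ℕ → Fin dx → ℝ}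
  {Θ : Set (Param dx dz)} {H : Set ℝ} {prior : Param dx dz × ℝ → ℝ} {θ₀ : Param dx dz} {τ₀ : ℝ}

/-- The part of the assumptions on the parameter space and the prior that drives posterior
contraction: regularity at the truth `(θ₀, τ₀)`. -/
structure LocallyRegularPrior (Θ : Set (Param dx dz)) (H : Set ℝ) (prior : Param dx dz × ℝ → ℝ)
    (θ₀ : Param dx dz) (τ₀ : ℝ) : Prop where
  compact : IsCompact Θ
  variance_pos : ∀ θ ∈ Θ, 0 < θ.2
  mem_nhds : Θ ∈ 𝓝 θ₀
  measurable : Measurable prior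
  nonneg : ∀ p, 0 ≤ prior p
  total_mass : ∫ p, prior p = 1
  supported : ∀ p ∉ Θ ×ˢ H, prior p = 0
  regular : ∃ W ∈ 𝓝 (θ₀, τ₀), ∃ c C : ℝ, 0 < c ∧ ∀ p ∈ W ∩ Θ ×ˢ H, c ≤ prior p ∧ prior p ≤ C

lemma RegularPrior.locallyRegularPrior {θstar : ℝ → Param dx dz}
    (h : RegularPrior Θ H prior θstar) (hτ₀ : τ₀ ∈ H) :
    LocallyRegularPrior Θ H prior (θstar τ₀) τ₀ := by
  obtain ⟨W, hW, -, hbound⟩ := h.regular τ₀ hτ₀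
  exact ⟨h.compact, h.variance_pos, mem_interior_iff_mem_nhds.mp (h.star_mem τ₀ hτ₀),
    h.measurable, h.nonneg, h.total_mass, h.supported, W, hW, hbound⟩

namespace LocallyRegularPrior

lemma bayesModel_normalLik (h : LocallyRegularPrior Θ H prior θ₀ τ₀) :
    BayesModel volume (normalLik R T y x) prior Θ H := by
  obtain ⟨b, hb⟩ := exists_normalLik_le (R := R) (T := T) (y := y) (x := x) h.compact
    h.variance_pos
  have hprior : Integrable prior := .of_integral_ne_zero (h.total_mass.trans_ne one_ne_zero)
  refine ⟨normalLik_nonneg, fun τ => ?_, h.nonneg, h.total_mass, h.supported, ?_⟩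
  · refine Measure.integrableOn_of_bounded (M := b) h.compact.measure_lt_top.ne
      (measurable_normalLik.comp (measurable_id.prodMk measurable_const)).aestronglyMeasurable ?_
    filter_upwards [ae_restrict_mem h.compact.measurableSet] with θ hθ
    rw [Real.norm_of_nonneg (normalLik_nonneg θ τ)]
    exact hb θ hθ τ
  · refine (hprior.const_mul b).mono' (measurable_normalLik.mul h.measurable).aestronglyMeasurable
      (ae_of_all _ fun p => ?_)
    rw [Real.norm_of_nonneg (mul_nonneg (normalLik_nonneg _ _) (h.nonneg p))]
    by_cases hp : p ∈ Θ ×ˢ H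
    · exact mul_le_mul_of_nonneg_right (hb p.1 hp.1 p.2) (h.nonneg p)
    · simp only [h.supported p hp, mul_zero, le_refl]

lemma integrable_margLik (h : LocallyRegularPrior Θ H prior θ₀ τ₀) :
    Integrable (margLik R prior T y x) :=
  (h.bayesModel_normalLik (R := R) (T := T) (y := y) (x := x)).integrable_mul.integral_prod_right

lemma setIntegral_margLik_pos (h : LocallyRegularPrior Θ H prior θ₀ τ₀) :
    0 < ∫ τ in H, margLik R prior T y x τ :=
  h.bayesModel_normalLik.evidence_pos fun θ hθ => normalLik_pos (h.variance_pos θ hθ)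

lemma exists_eventually_prior_bounds (h : LocallyRegularPrior Θ H prior θ₀ τ₀) :
    ∃ U ∈ 𝓝 θ₀, ∃ lo hi : ℝ, 0 < lo ∧ 0 ≤ hi ∧ ∀ᶠ κ in 𝓝[>] (0 : ℝ), ∀ θ ∈ U ∩ Θ, ∀ τ ∈ H,
      |τ - τ₀| < κ → lo ≤ prior (θ, τ) ∧ prior (θ, τ) ≤ hi := by
  obtain ⟨W, hW, lo, hi, hlo, hbound⟩ := h.regular
  obtain ⟨U, hU, V, hV, hUV⟩ := mem_nhds_prod_iff.mp hW
  obtain ⟨r, hr, hrV⟩ := Metric.mem_nhds_iff.mp hV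
  refine ⟨U, hU, lo, max hi 0, hlo, le_max_right _ _, ?_⟩
  filter_upwards [Ioo_mem_nhdsGT hr] with κ hκ θ hθ τ hτ hτκ
  have hp := hbound (θ, τ) ⟨hUV ⟨hθ.1, hrV (hτκ.trans hκ.2)⟩, hθ.2, hτ⟩
  exact ⟨hp.1, hp.2.trans (le_max_left _ _)⟩

end LocallyRegularPrior

end Prior

section Contraction

lemma exists_eventually_exp_add_exp_lt {a ζ η : ℝ} (ha : 0 < a) (hζ : 0 < ζ) (hη : 0 < η)
    (C₁ C₂ : ℝ) : ∃ m : ℝ, 0 < m ∧ ∀ᶠ T : ℕ in atTop,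
      C₁ * Real.exp (-(a * m)) + C₂ * (T * Real.exp (-(ζ * T))) < η := by
  have hlim₁ : Tendsto (fun m : ℝ => C₁ * Real.exp (-(a * m))) atTop (𝓝 0) := by
    simpa using (Real.tendsto_exp_neg_atTop_nhds_zero.comp
      (tendsto_id.const_mul_atTop ha)).const_mul C₁
  obtain ⟨m, hm, hm0⟩ := ((hlim₁.eventually_lt_const hη).and (eventually_gt_atTop 0)).exists
  have hlim₂ : Tendsto (fun T : ℕ => C₂ * (T * Real.exp (-(ζ * T)))) atTop (𝓝 0) := by
    have hpow := (Real.tendsto_pow_mul_exp_neg_atTop_nhds_zero 1).comp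
      (tendsto_natCast_atTop_atTop.const_mul_atTop hζ)
    have hscaled := (hpow.const_mul ζ⁻¹).const_mul C₂
    simp only [mul_zero] at hscaled
    refine hscaled.congr fun T => ?_
    simp only [Function.comp_apply, pow_one]
    field_simp
  refine ⟨m, hm0, ?_⟩
  filter_upwards [hlim₂.eventually_lt_const (sub_pos.mpr hm)] with T hT
  linarith

lemma exists_subset_near {H : Set ℝ} {τ₀ a b : ℝ} (hab : a < b) (hτ₀ : τ₀ ∈ Icc a b)
    (hH : Icc a b ⊆ H) : ∃ ρ : ℝ, 0 < ρ ∧ ∀ l : ℝ, 0 < l → l ≤ ρ →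
      ∃ I ⊆ H, MeasurableSet I ∧ volume.real I = l ∧ ∀ τ ∈ I, |τ - τ₀| ≤ l := by
  rcases hτ₀.2.lt_or_eq with hlt | rfl
  · refine ⟨b - τ₀, sub_pos.mpr hlt, fun l hl hlρ => ⟨Icc τ₀ (τ₀ + l),
      (Icc_subset_Icc hτ₀.1 (by linarith)).trans hH, measurableSet_Icc, ?_, fun τ hτ => ?_⟩⟩
    · rw [Real.volume_real_Icc_of_le (by linarith), add_sub_cancel_left]
    · exact abs_le.mpr ⟨by linarith [hτ.1], by linarith [hτ.2]⟩
  · refine ⟨τ₀ - a, sub_pos.mpr hab, fun l hl hlρ => ⟨Icc (τ₀ - l) τ₀,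
      (Icc_subset_Icc (by linarith) le_rfl).trans hH, measurableSet_Icc, ?_, fun τ hτ => ?_⟩⟩
    · rw [Real.volume_real_Icc_of_le (by linarith), sub_sub_cancel]
    · exact abs_le.mpr ⟨by linarith [hτ.1], by linarith [hτ.2]⟩

variable {dx dz : ℕ} {R : Matrix (Fin dx) (Fin dz) ℝ} {S : Matrix (Fin dx) (Fin dx) ℝ}
  {γ₀ : (Fin dx → ℝ) × (Fin dz → ℝ)} {v₀ τ₀ : ℝ} {Θ : Set (Param dx dz)} {H : Set ℝ}
  {prior : Param dx dz × ℝ → ℝ}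

lemma one_sub_measureReal_not_le {Ω : Type*} [MeasurableSpace Ω] {μ : Measure Ω}
    [IsProbabilityMeasure μ] {P Q : Ω → Prop} (h : ∀ ω, P ω → Q ω) :
    1 - μ.real {ω | ¬ P ω} ≤ μ.real {ω | Q ω} := by
  have hcover : (univ : Set Ω) ⊆ {ω | Q ω} ∪ {ω | ¬ P ω} := fun ω _ =>
    (em (P ω)).imp_left (h ω)
  rw [sub_le_iff_le_add, ← probReal_univ (μ := μ)]
  exact (measureReal_mono hcover).trans (measureReal_union_le _ _)

lemma setIntegral_margPosterior (R : Matrix (Fin dx) (Fin dz) ℝ) (prior : Param dx dz × ℝ → ℝ)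
    (H A : Set ℝ) (T : ℕ) (y : ℕ → ℝ) (x : ℕ → Fin dx → ℝ) :
    ∫ τ in A, margPosterior R prior H T y x τ =
      (∫ τ in A, margLik R prior T y x τ) / ∫ τ in H, margLik R prior T y x τ :=
  integral_div _ _

lemma LocallyRegularPrior.exists_eventually_margPosterior_lt
    (h : LocallyRegularPrior Θ H prior (γ₀, v₀) τ₀) (hS : S.PosDef) (hR : R.rank = dz)
    (hδ : γ₀.2 ≠ 0) (hv₀ : 0 < v₀) (hH : MeasurableSet H) (hH01 : H ⊆ Ioo 0 1) {a₁ b₁ : ℝ}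
    (hab : a₁ < b₁) (hτ₀ : τ₀ ∈ Icc a₁ b₁) (habH : Icc a₁ b₁ ⊆ H) :
    ∃ κ c : ℝ, 0 < κ ∧ κ < τ₀ ∧ 0 < c ∧ ∀ M : ℕ, ∀ η : ℝ, 0 < η → ∃ m : ℝ, 0 < m ∧
      ∀ᶠ T : ℕ in atTop, ∀ x ε, SampleRegular S v₀ κ c M T (strictFloor (τ₀ * T)) x ε →
        ∫ τ in H \ Ioo (τ₀ - m / T) (τ₀ + m / T), margPosterior R prior H T
          (fun t => regMean R T τ₀ γ₀ t (x t) + ε t) x τ < η := by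
  obtain ⟨hτ0, hτ1⟩ := hH01 (habH hτ₀)
  obtain ⟨U, hU, lo, hi, hlo, hhi, hprior⟩ := h.exists_eventually_prior_bounds
  have hroom : 0 < min τ₀ (1 - τ₀) / 3 := by
    have := lt_min hτ0 (sub_pos.mpr hτ1)
    positivity
  obtain ⟨κ, hbound, hκ, hκle⟩ := (hprior.and (Ioc_mem_nhdsGT hroom)).exists
  have hκτ : 3 * κ ≤ τ₀ := by linarith [min_le_left τ₀ (1 - τ₀)]
  have hκτ' : 3 * κ ≤ 1 - τ₀ := by linarith [min_le_right τ₀ (1 - τ₀)]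
  obtain ⟨B, B', ζ, a, c, hB, hB', hθ₀, hB'B, hBU, hζ, ha, hc, hsep⟩ :=
    exists_likelihoodSeparated hS hR hδ hv₀ h.compact h.variance_pos h.mem_nhds hU hκτ hκτ' hκ
  have hvol : 0 < volume.real B' := ENNReal.toReal_pos (hB'.measure_pos volume ⟨_, hθ₀⟩).ne'
    (measure_ne_top_of_subset (hB'B.trans (hBU.trans inter_subset_right))
      h.compact.measure_lt_top.ne)
  obtain ⟨ρ, hρ, hI⟩ := exists_subset_near hab hτ₀ habH
  refine ⟨2 * κ, c, by positivity, by linarith, hc, fun M η hη => ?_⟩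
  obtain ⟨K, hsep⟩ := hsep M
  obtain ⟨m, hm, hsmall⟩ := exists_eventually_exp_add_exp_lt (half_pos ha) hζ hη
    (4 * hi * Real.exp (2 * K) / (a * lo)) (Real.exp K / (lo * volume.real B'))
  refine ⟨m, hm, ?_⟩
  filter_upwards [hsmall, eventually_gt_atTop 0,
    (tendsto_natCast_atTop_atTop.const_mul_atTop hκ).eventually_ge_atTop 2,
    (tendsto_one_div_atTop_nhds_zero_nat (𝕜 := ℝ)).eventually_le_const hρ]
    with T hsmall hT hTκ hTρ x ε hreg
  have hT' : (0 : ℝ) < T := Nat.cast_pos.mpr hT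
  obtain ⟨I, hIH, hI, hIvol, hIτ⟩ := hI (1 / T) (by positivity) hTρ
  have hIκ : 1 / (T : ℝ) < κ := (div_lt_iff₀ hT').mpr (by linarith)
  rw [setIntegral_margPosterior]
  exact ((hsep T x ε hTκ hreg).setIntegral_diff_div_le h.bayesModel_normalLik
    (normalLik_pos hv₀ τ₀) hB.measurableSet (hBU.trans inter_subset_right) hB'.measurableSet
    hB'B hvol hH hH01 (fun θ hθ => hbound θ (hBU hθ)) hlo hhi ha hT hI hIH hIvol
    (fun τ hτ => (hIτ τ hτ).trans_lt hIκ)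
    (fun τ hτ => (le_div_iff₀' hT').mp (hIτ τ hτ))).trans_lt hsmall

end Contraction

end BreakModel

end

theorem theorem3_general {Ω : Type*} [MeasurableSpace Ω] (μ : Measure Ω) [IsProbabilityMeasure μ]
    {dx dz : ℕ} (R : Matrix (Fin dx) (Fin dz) ℝ) (hR : R.rank = dz)
    (x : ℕ → Ω → Fin dx → ℝ) (ε : ℕ → Ω → ℝ) (γ₀ : (Fin dx → ℝ) × (Fin dz → ℝ)) (hδ₀ : γ₀.2 ≠ 0)
    (σ₀sq : ℝ) (SigmaX : Matrix (Fin dx) (Fin dx) ℝ)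
    (hdgp : BreakModel.ErgodicMoments μ x ε SigmaX σ₀sq)
    (H : Set ℝ) (hH : MeasurableSet H) (hH01 : H ⊆ Set.Ioo 0 1)
    (τ₀ : ℝ) (hτ₀ : ∃ a b : ℝ, a < b ∧ τ₀ ∈ Set.Icc a b ∧ Set.Icc a b ⊆ H)
    (Θ : Set (BreakModel.Param dx dz)) (prior : BreakModel.Param dx dz × ℝ → ℝ)
    (hprior : BreakModel.LocallyRegularPrior Θ H prior (γ₀, σ₀sq) τ₀) :
    (∀ (T : ℕ) (ω : Ω),
      IntegrableOn (BreakModel.margLik R prior T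
        (BreakModel.response R x ε γ₀ τ₀ T ω) (fun t => x t ω)) H ∧
      0 < ∫ τ in H, BreakModel.margLik R prior T
        (BreakModel.response R x ε γ₀ τ₀ T ω) (fun t => x t ω) τ) ∧
    ∀ η : ℝ, 0 < η → ∀ e : ℝ, 0 < e → ∃ M : ℝ, 0 < M ∧ ∃ k : ℕ, 0 < k ∧ ∀ T : ℕ, k ≤ T →
      1 - e < μ.real {ω | ∫ τ in H \ Set.Ioo (τ₀ - M / T) (τ₀ + M / T),
        BreakModel.margPosterior R prior H T
          (BreakModel.response R x ε γ₀ τ₀ T ω) (fun t => x t ω) τ < η} := by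
  refine ⟨fun T ω => ⟨hprior.integrable_margLik.integrableOn, hprior.setIntegral_margLik_pos⟩,
    fun η hη e he => ?_⟩
  obtain ⟨a, b, hab, hτab, habH⟩ := hτ₀
  obtain ⟨κ, c, hκ, hκτ, hc, hcontract⟩ := hprior.exists_eventually_margPosterior_lt
    hdgp.posDef hR hδ₀ hdgp.variance_pos hH hH01 hab hτab habH
  obtain ⟨N, hregular⟩ := hdgp.exists_sampleRegular hκ hκτ hc (half_pos he)
  obtain ⟨M, hM, hlt⟩ := hcontract N η hη
  obtain ⟨k, hk⟩ := eventually_atTop.mp (hregular.and hlt)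
  refine ⟨M, hM, k + 1, k.succ_pos, fun T hT => ?_⟩
  obtain ⟨hbad, hgood⟩ := hk T (Nat.le_of_succ_le hT)
  exact (by linarith : 1 - e < _).trans_le
    (BreakModel.one_sub_measureReal_not_le fun ω => hgood (fun t => x t ω) fun t => ε t ω)

theorem theorem3 {Ω : Type*} [MeasurableSpace Ω] (μ : Measure Ω) [IsProbabilityMeasure μ]
    {dx dz : ℕ} (R : Matrix (Fin dx) (Fin dz) ℝ) (hR : R.rank = dz)
    (X : Set (Fin dx → ℝ)) (x : ℕ → Ω → Fin dx → ℝ) (ε : ℕ → Ω → ℝ)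
    (γ₀ : (Fin dx → ℝ) × (Fin dz → ℝ)) (σ₀sq : ℝ) (SigmaX : Matrix (Fin dx) (Fin dx) ℝ)
    (hdgp : BreakModel.RegularDGP μ X x ε γ₀.2 σ₀sq SigmaX)
    (H : Set ℝ) (hH : MeasurableSet H) (hH01 : H ⊆ Set.Ioo 0 1)
    (τ₀ : ℝ) (hτ₀ : ∃ a b : ℝ, a < b ∧ τ₀ ∈ Set.Icc a b ∧ Set.Icc a b ⊆ H)
    (Θ : Set (BreakModel.Param dx dz)) (prior : BreakModel.Param dx dz × ℝ → ℝ)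
    (hprior : BreakModel.RegularPrior Θ H prior (BreakModel.pseudoTrue μ R x ε γ₀ τ₀)) :
    (∀ (T : ℕ) (ω : Ω),
      IntegrableOn (BreakModel.margLik R prior T
        (BreakModel.response R x ε γ₀ τ₀ T ω) (fun t => x t ω)) H ∧
      0 < ∫ τ in H, BreakModel.margLik R prior T
        (BreakModel.response R x ε γ₀ τ₀ T ω) (fun t => x t ω) τ) ∧
    ∀ η : ℝ, 0 < η → ∀ e : ℝ, 0 < e → ∃ M : ℝ, 0 < M ∧ ∃ k : ℕ, 0 < k ∧ ∀ T : ℕ, k ≤ T →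
      1 - e < μ.real {ω | ∫ τ in H \ Set.Ioo (τ₀ - M / T) (τ₀ + M / T),
        BreakModel.margPosterior R prior H T
          (BreakModel.response R x ε γ₀ τ₀ T ω) (fun t => x t ω) τ < η} := by
  have hmem : τ₀ ∈ H := let ⟨_, _, _, hτab, habH⟩ := hτ₀; habH hτab
  have hstar := hdgp.ergodicMoments.pseudoTrue_eq hR (γ₀ := γ₀) (hH01 hmem).1 (hH01 hmem).2
  exact theorem3_general μ R hR x ε γ₀ hdgp.jump_ne_zero σ₀sq SigmaX hdgp.ergodicMoments H hH hH01
    τ₀ hτ₀ Θ prior (hstar ▸ hprior.locallyRegularPrior hmem)
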